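/- Let $\zeta$ be the Riemann zeta function and let $\xi(s)=s(s-1)\pi^{-s/2}\Gamma(s/2)\zeta(s)$, an entire function with $\xi(0)=1$. Let $\ell_k$ $(k\ge 0)$ be the Taylor coefficients at $0$ of its logarithmic derivative, $$\frac{\xi'(s)}{\xi(s)}=\sum_{k\ge0}\ell_k s^k\quad\text{near } s=0 .$$ For $x\in\mathbb{C}$ and $\tau\neq 0$ let $$F(x,\tau)=\frac1\tau\sum_{\rho}\left[1-\left(\frac{\rho}{\rho-\tau}\right)^{x}\right],$$ where $\rho$ runs over the nontrivial zeros of $\zeta$ (those with $0<\operatorname{Re}\rho<1$), counted with multiplicity, the terms of $\rho$ and $1-\rho$ are paired together, and powers take their principal value. Let $R$ be the absolute value of the first zero of $\zeta$ on the critical line $\operatorname{Re}s=\tfrac12$, that is, the least modulus of a zero on that line; $R$ is also the least modulus of all nontrivial zeros. Then for all $x\in\mathbb{C}$ and all $\tau\in\mathbb C$ with $0<|\tau|<R$ the paired sum defining $F(x,\tau)$ converges absolutely and $$F(x,\tau)=\sum_{k=0}^{\infty}\frac{\ell_k}{(k+1)!}\,\frac{\Gamma(x+k+1)}{\Gamma(x)}\,\tau^{k}.$$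 At $\tau=0$ the formula holds with $F(x,0)$ understood as $\lim_{\tau\to0}F(x,\tau)$. Here $\Gamma(x+k+1)/\Gamma(x)$ is understood at $x=0,-1,-2,\dots$ by continuity, i.e. as $x(x+1)\cdots(x+k)$. -/

import Mathlib

open Filter Topology

/-- The function `ξ(s) = s (s - 1) π^(-s/2) Γ(s/2) ζ(s)` as an entire function, normalised by
`ξ(0) = ξ(1) = 1`. It is written through Mathlib's entire function
`Λ₀(s) = π^(-s/2) Γ(s/2) ζ(s) + 1/s + 1/(1-s)`, so that the removable singularities of the
product (at `0`, `1` and the poles of `Γ(s/2)`) carry the right values; see `riemannXi_eq`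
and `differentiable_riemannXi`. -/
noncomputable def riemannXi (s : ℂ) : ℂ :=
  s * (s - 1) * completedRiemannZeta₀ s + 1

theorem differentiable_riemannXi : Differentiable ℂ riemannXi := by
  unfold riemannXi
  exact ((differentiable_id.mul (differentiable_id.sub_const 1)).mul
    differentiable_completedZeta₀).add_const 1

theorem riemannXi_eq {s : ℂ} (h1 : s ≠ 1) (h : ∀ n : ℕ, s ≠ -(2 * n)) :
    riemannXi s =
      s * (s - 1) * (Real.pi : ℂ) ^ (-s / 2) * Complex.Gamma (s / 2) * riemannZeta s := by
  have h0 : s ≠ 0 := by simpa using h 0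
  have h1' : (1 : ℂ) - s ≠ 0 := sub_ne_zero.mpr (Ne.symm h1)
  have hG : Complex.Gamma (s / 2) ≠ 0 := by
    apply Complex.Gamma_ne_zero
    intro n hn
    apply h n
    linear_combination 2 * hn
  have hpi : (Real.pi : ℂ) ^ (-s / 2) ≠ 0 := by
    simp [Complex.cpow_eq_zero_iff, Real.pi_ne_zero]
  rw [riemannZeta_eq_completedRiemannZeta₀ h0, riemannXi]
  field_simp
  ring

/-- The `k`-th Taylor coefficient at `0` of the logarithmic derivative `ξ'(s)/ξ(s)`. -/
noncomputable def xiLogDerivCoeff (k : ℕ) : ℂ :=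
  iteratedDeriv k (logDeriv riemannXi) 0 / (k.factorial : ℂ)

/-- The nontrivial zeros of the Riemann zeta function. -/
def nontrivialZetaZeros : Set ℂ :=
  {ρ | riemannZeta ρ = 0 ∧ 0 < ρ.re ∧ ρ.re < 1}

/-- The zeros of the Riemann zeta function on the critical line `Re s = 1/2`. -/
def criticalLineZetaZeros : Set ℂ :=
  {ρ | riemannZeta ρ = 0 ∧ ρ.re = 1 / 2}

/-- The multiplicity of `ρ` as a zero of the Riemann zeta function. -/
noncomputable def zetaZeroMult (ρ : ℂ) : ℕ := analyticOrderNatAt riemannZeta ρ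

/-- The term `1 - (ρ / (ρ - τ)) ^ x`, with the principal value of the power. -/
noncomputable def zetaZeroTerm (x τ ρ : ℂ) : ℂ := 1 - (ρ / (ρ - τ)) ^ x

/-- The contribution of `ρ`, with multiplicity, to the sum over the nontrivial zeros in which the
terms of `ρ` and `1 - ρ` are paired together. A pair `{ρ, 1 - ρ}` with `ρ ≠ 1 - ρ` is met twice
when `ρ` runs over all zeros, hence the factor `1/2`; it is also right for `ρ = 1 - ρ`. -/
noncomputable def pairedZetaZeroTerm (x τ ρ : ℂ) : ℂ :=
  (zetaZeroMult ρ : ℂ) * ((zetaZeroTerm x τ ρ + zetaZeroTerm x τ (1 - ρ)) / 2)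

/-- `F(x, τ) = (1/τ) ∑_ρ [1 - (ρ / (ρ - τ)) ^ x]` for `τ ≠ 0`, the sum over the nontrivial zeros
of zeta with multiplicity, the terms of `ρ` and `1 - ρ` being paired. -/
noncomputable def liFunction (x τ : ℂ) : ℂ :=
  1 / τ * ∑' ρ : nontrivialZetaZeros, pairedZetaZeroTerm x τ ρ

open Classical in
/-- The function `Γ(x + k + 1) / Γ(x)` of `x`, with its removable singularities at
`x = 0, -1, -2, …` filled in by continuity; see `gammaQuotient_eq_prod`. -/
noncomputable def gammaQuotient (x : ℂ) (k : ℕ) : ℂ :=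
  if ∃ p : ℕ, x = -(p : ℂ) then ∏ j ∈ Finset.range (k + 1), (x + j)
  else Complex.Gamma (x + k + 1) / Complex.Gamma x

theorem gammaQuotient_eq_prod (x : ℂ) (k : ℕ) :
    gammaQuotient x k = ∏ j ∈ Finset.range (k + 1), (x + j) := by
  unfold gammaQuotient
  split_ifs with h
  · rfl
  · push Not at h
    have hG : Complex.Gamma x ≠ 0 := Complex.Gamma_ne_zero h
    rw [div_eq_iff hG]
    induction k with
    | zero =>
      have h0 : x ≠ 0 := by simpa using h 0
      simp [Complex.Gamma_add_one x h0]
    | succ k ih =>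
      have hk : x + k + 1 ≠ 0 := fun hk => h (k + 1) (by push_cast; linear_combination hk)
      rw [Finset.prod_range_succ]
      push_cast
      rw [← add_assoc, Complex.Gamma_add_one _ hk, ih]
      ring

theorem continuous_gammaQuotient (k : ℕ) : Continuous fun x => gammaQuotient x k := by
  simp only [gammaQuotient_eq_prod]
  fun_prop

/-! ### Even entire functions of order less than two -/

/-! As `1 - τ/ρ` stays off the negative axis, each term is `1 - (1 - τ/ρ)^(-x)`, and the binomial
series makes it a power series in `τ/ρ` without constant term. Summing over the zeros produces `∑
ρ^(-k-1)` in the coefficient of `τ^(k+1)`, and this is `-ℓ_k` by the partial fractions of `ξ'/ξ`.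
The interchanges rest on `∑ |ρ|^(-2) < ∞`; pairing is needed only at `k = 0`, where `1/ρ + 1/(1-ρ) =
1/(ρ(1-ρ))`. See `hasSum_zetaZeroTerm`, `hasSum_logDeriv_riemannXi`, `HasSum.swap_of_norm_le`.

The partial fractions come without Hadamard's theorem. Centred at `1/2`, `ξ` is even and at most
`exp(o(r²))` on discs of radius `r`. Dividing out the zeros in such a disc leaves a zero-free factor
whose logarithm is `o(1)` on compact sets (`exists_log_quotient_bound`). Letting `r → ∞` expresses
both `ξ'/ξ` and `log|ξ|` as sums over zeros.

That the least modulus is attained on the critical line is an explicit computation. Put `v = -(ρ -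
1/2)²`. The values of `log|ξ|` at `1, 2, 4, 6, 8` are known, and suitable combinations of them are
sums over the zeros of kernels in `v` that decay like `v^(-3)` (`kernelA`) and `v^(-4)` (`kernelB`).
An off-line zero with `Re v ≤ 236` would come with three companions, and the four together would
exceed the total of the nonnegative `kernelA`. If all zeros had `Re v ≥ 234`, the termwise bound
`kernelB ≤ kernelA / 320` would contradict the two totals. So some zero has `Re v < 234`; it lies on
the line, and every off-line zero has larger modulus. -/

theorem Differentiable.exists_eq_sub_pow_mul {f : ℂ → ℂ} (hf : Differentiable ℂ f) (a : ℂ)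
    (h : analyticOrderAt f a ≠ ⊤) :
    ∃ g : ℂ → ℂ, Differentiable ℂ g ∧ g a ≠ 0 ∧
      ∀ z, f z = (z - a) ^ analyticOrderNatAt f a * g z := by
  obtain ⟨n, hn⟩ := ENat.ne_top_iff_exists.mp h
  rw [analyticOrderNatAt, ← hn, ENat.toNat_natCast]
  clear h
  induction n generalizing f with
  | zero =>
    exact ⟨f, hf, (hf.analyticAt a).analyticOrderAt_eq_zero.mp (by simpa using hn.symm), by simp⟩
  | succ n ih =>
    have hfa : f a = 0 := by
      by_contra hne
      rw [(hf.analyticAt a).analyticOrderAt_eq_zero.mpr hne] at hn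
      simp at hn
    have hd : Differentiable ℂ (dslope f a) := by
      rw [← differentiableOn_univ] at hf ⊢
      exact (Complex.differentiableOn_dslope univ_mem).mpr hf
    have hfac : f = (fun z => z - a) * dslope f a := by
      ext z
      have := sub_smul_dslope f a z
      simp only [smul_eq_mul, hfa, sub_zero] at this
      simp [this]
    have hid : analyticOrderAt (fun z : ℂ => z - a) a = 1 := by
      simp
    have hord : (n : ℕ∞) = analyticOrderAt (dslope f a) a := by
      rw [hfac, analyticOrderAt_mul (by fun_prop) (hd.analyticAt a), hid] at hn
      push_cast at hn
      rw [add_comm 1] at hn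
      exact ENat.add_left_injective_of_ne_top ENat.one_ne_top hn
    obtain ⟨g, hg, hga, hgf⟩ := ih hd hord
    refine ⟨g, hg, hga, fun z => ?_⟩
    rw [hfac, Pi.mul_apply, hgf z]
    ring

theorem Differentiable.analyticOrderAt_ne_top {f : ℂ → ℂ} (hf : Differentiable ℂ f) {b : ℂ}
    (hb : f b ≠ 0) (a : ℂ) : analyticOrderAt f a ≠ ⊤ := by
  intro h
  rw [analyticOrderAt_eq_top] at h
  exact hb (AnalyticOnNhd.eqOn_zero_of_preconnected_of_eventuallyEq_zero
    (fun z _ => hf.analyticAt z) isPreconnected_univ (Set.mem_univ a) h (Set.mem_univ b))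

theorem analyticOrderNatAt_comp_neg {f : ℂ → ℂ} (hf : Differentiable ℂ f)
    (heven : ∀ z, f (-z) = f z) {b : ℂ} (hb : f b ≠ 0) (a : ℂ) :
    analyticOrderNatAt f (-a) = analyticOrderNatAt f a := by
  rw [(hf.analyticAt (-a)).analyticOrderNatAt_eq_iff (hf.analyticOrderAt_ne_top hb _)]
  obtain ⟨g, hg, hga, hgf⟩ := hf.exists_eq_sub_pow_mul a (hf.analyticOrderAt_ne_top hb _)
  refine ⟨fun z => (-1) ^ analyticOrderNatAt f a * g (-z), ?_, by simpa using hga,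
    .of_forall fun z => ?_⟩
  · exact Differentiable.analyticAt (by fun_prop) _
  · rw [← heven, hgf, smul_eq_mul, ← mul_assoc, ← mul_pow]
    congr 2
    ring

/-- The product of the factors `(1 - z / a) ^ m` over a finite set of points `a`, with `m` the
order of vanishing of `f` at `a`. -/
noncomputable def zeroProd (f : ℂ → ℂ) (Z : Finset ℂ) (z : ℂ) : ℂ :=
  ∏ a ∈ Z, (1 - z / a) ^ analyticOrderNatAt f a

theorem differentiable_zeroProd (f : ℂ → ℂ) (Z : Finset ℂ) : Differentiable ℂ (zeroProd f Z) := by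
  unfold zeroProd
  fun_prop

theorem zeroProd_zero (f : ℂ → ℂ) (Z : Finset ℂ) : zeroProd f Z 0 = 1 := by
  simp [zeroProd]

theorem zeroProd_ne_zero (f : ℂ → ℂ) {Z : Finset ℂ} (h0 : ∀ a ∈ Z, a ≠ 0) {z : ℂ}
    (hz : z ∉ Z) : zeroProd f Z z ≠ 0 := by
  refine Finset.prod_ne_zero_iff.mpr fun a ha => pow_ne_zero _ ?_
  rw [sub_ne_zero, ne_eq, eq_comm, div_eq_one_iff_eq (h0 a ha)]
  rintro rfl
  exact hz ha

theorem Differentiable.exists_eq_zeroProd_mul {f : ℂ → ℂ} (hf : Differentiable ℂ f) {b : ℂ}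
    (hb : f b ≠ 0) (Z : Finset ℂ) (hZ : ∀ a ∈ Z, a ≠ 0) :
    ∃ g : ℂ → ℂ, Differentiable ℂ g ∧ (∀ a ∈ Z, g a ≠ 0) ∧ ∀ z, f z = zeroProd f Z z * g z := by
  classical
  induction Z using Finset.induction_on with
  | empty => exact ⟨f, hf, by simp, by simp [zeroProd]⟩
  | insert a Z ha ih =>
    obtain ⟨g, hg, hgZ, hfg⟩ := ih fun c hc => hZ c (Finset.mem_insert_of_mem hc)
    have hPa : zeroProd f Z a ≠ 0 :=
      zeroProd_ne_zero f (fun c hc => hZ c (Finset.mem_insert_of_mem hc)) ha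
    have hgb : g b ≠ 0 := fun h => hb (by rw [hfg, h, mul_zero])
    have hP := differentiable_zeroProd f Z
    have hPb : zeroProd f Z b ≠ 0 := fun h => hb (by rw [hfg, h, zero_mul])
    have hord : analyticOrderNatAt f a = analyticOrderNatAt g a := by
      have hfe : f = zeroProd f Z * g := funext hfg
      conv_lhs => rw [hfe]
      rw [analyticOrderNatAt_mul (hP.analyticAt a) (hg.analyticAt a)
        (hP.analyticOrderAt_ne_top hPb a) (hg.analyticOrderAt_ne_top hgb a)]
      simp [analyticOrderNatAt, (hP.analyticAt a).analyticOrderAt_eq_zero.mpr hPa]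
    obtain ⟨k, hk, hka, hgk⟩ := hg.exists_eq_sub_pow_mul a (hg.analyticOrderAt_ne_top hgb a)
    have ha0 : a ≠ 0 := hZ a (Finset.mem_insert_self a Z)
    refine ⟨fun z => (-a) ^ analyticOrderNatAt g a * k z, by fun_prop, ?_, fun z => ?_⟩
    · intro c hc
      refine mul_ne_zero (pow_ne_zero _ (neg_ne_zero.mpr ha0)) ?_
      rcases Finset.mem_insert.mp hc with rfl | hc
      · exact hka
      · intro h0
        exact hgZ c hc (by rw [hgk, h0, mul_zero])
    · rw [zeroProd, Finset.prod_insert ha, hfg z, hgk z, zeroProd, hord]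
      have : (z - a) = (-a) * (1 - z / a) := by field_simp; ring
      rw [this, mul_pow]
      ring

/-- If `h` is even and entire, of modulus at most `‖h 0‖ exp M` on the disc of radius `3 r`, then
`h` is `h 0` times the product over its zeros in the disc of radius `r` times the exponential of a
function which is quadratically small near `0`. -/
theorem exists_log_quotient_bound {h : ℂ → ℂ} (hd : Differentiable ℂ h)
    (heven : ∀ z, h (-z) = h z) (h0 : h 0 ≠ 0) {r M : ℝ} (hr : 0 < r) (hM : 0 < M)
    (hbound : ∀ z, ‖z‖ ≤ 3 * r → ‖h z‖ ≤ ‖h 0‖ * Real.exp M) (Z : Finset ℂ)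
    (hZ : ∀ a, a ∈ Z ↔ ‖a‖ ≤ r ∧ h a = 0) :
    ∃ L L' : ℂ → ℂ, ∀ z, ‖z‖ < r / 4 → HasDerivAt L (L' z) z ∧
      h z = h 0 * zeroProd h Z z * Complex.exp (L z) ∧
      ‖L' z‖ ≤ 32 * M / r ^ 2 * ‖z‖ ∧ ‖L z‖ ≤ 32 * M / r ^ 2 * ‖z‖ ^ 2 := by
  have hZ0 : ∀ a ∈ Z, a ≠ 0 := by
    rintro a ha rfl
    exact h0 ((hZ 0).mp ha).2
  obtain ⟨g, hg, hgZ, hfg⟩ := hd.exists_eq_zeroProd_mul h0 Z hZ0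
  have hg0 : g 0 = h 0 := by rw [hfg 0, zeroProd_zero, one_mul]
  have hgne : ∀ z ∈ Metric.ball (0 : ℂ) r, g z ≠ 0 := by
    intro z hz hgz
    have : z ∈ Z := (hZ z).mpr
      ⟨by simpa using (mem_ball_zero_iff.mp hz).le, by rw [hfg, hgz, mul_zero]⟩
    exact hgZ z this hgz
  -- On `|w| = 3r` every factor satisfies `|1 - w/a| ≥ 3 - 1`, so dividing by the product cannot
  -- enlarge `h` there; the maximum principle carries the bound inwards.
  have hgbound : ∀ z ∈ Metric.closedBall (0 : ℂ) (3 * r), ‖g z‖ ≤ ‖h 0‖ * Real.exp M := by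
    intro z hz
    rw [← closure_ball (0 : ℂ) (by positivity : 3 * r ≠ 0)] at hz
    refine Complex.norm_le_of_forall_mem_frontier_norm_le Metric.isBounded_ball
      hg.diffContOnCl (fun w hw => ?_) hz
    rw [frontier_ball (0 : ℂ) (by positivity), mem_sphere_zero_iff_norm] at hw
    have hP : 1 ≤ ‖zeroProd h Z w‖ := by
      rw [zeroProd, norm_prod]
      refine Finset.prod_induction _ (fun x : ℝ => 1 ≤ x)
        (fun _ _ => one_le_mul_of_one_le_of_one_le)
        le_rfl fun a ha => ?_
      rw [norm_pow]
      refine one_le_pow₀ ?_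
      have ha0 : 0 < ‖a‖ := norm_pos_iff.mpr (hZ0 a ha)
      have har : ‖a‖ ≤ r := ((hZ a).mp ha).1
      have h1 : 3 ≤ ‖w / a‖ := by
        rw [norm_div, hw, le_div_iff₀ ha0]
        linarith
      have h2 := norm_sub_norm_le (w / a) 1
      rw [norm_one, norm_sub_rev] at h2
      linarith
    calc ‖g w‖ ≤ ‖zeroProd h Z w‖ * ‖g w‖ := le_mul_of_one_le_left (norm_nonneg _) hP
      _ = ‖h w‖ := by rw [← norm_mul, ← hfg]
      _ ≤ _ := hbound w hw.le
  have hsym : ∀ a, a ∈ Z ↔ -a ∈ Z := fun a => by rw [hZ, hZ, norm_neg, heven]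
  have hPeven : ∀ z, zeroProd h Z (-z) = zeroProd h Z z := by
    intro z
    unfold zeroProd
    refine Finset.prod_nbij' (fun a => -a) (fun a => -a) (fun a ha => (hsym a).mp ha)
      (fun a ha => (hsym a).mp ha) (by simp) (by simp) fun a _ => ?_
    rw [analyticOrderNatAt_comp_neg hd heven h0, neg_div, div_neg]
  have hgeven : ∀ᶠ z in 𝓝 (0 : ℂ), g (-z) = g z := by
    have hcont := (differentiable_zeroProd h Z).continuous.continuousAt (x := 0)
    filter_upwards [hcont.eventually_ne (by rw [zeroProd_zero]; exact one_ne_zero)] with z hz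
    have h1 := heven z
    rw [hfg, hfg z, hPeven] at h1
    exact mul_left_cancel₀ hz h1
  -- Evenness removes the linear term of `log g`. This gains a factor `|z|/r`, so that `M = o(r²)`
  -- suffices instead of `M = o(r)`.
  have hdg0 : deriv g 0 = 0 := by
    have h1 : deriv (fun z => g (-z)) 0 = deriv g 0 := Filter.EventuallyEq.deriv_eq hgeven
    rw [deriv_comp_neg, neg_zero] at h1
    linear_combination (-1 / 2 : ℂ) * h1
  have hlog : DifferentiableOn ℂ (fun z => deriv g z / g z) (Metric.ball 0 r) :=
    fun z hz => ((hg.contDiff.differentiable_deriv_two z).div (hg z)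
      (hgne z hz)).differentiableWithinAt
  obtain ⟨L, hL0, hL⟩ := hlog.isExactOn_ball.with_val_at 0 0
  have hLd : DifferentiableOn ℂ L (Metric.ball 0 r) :=
    fun z hz => (hL z hz).differentiableAt.differentiableWithinAt
  have hexp : ∀ z ∈ Metric.ball (0 : ℂ) r, g z = h 0 * Complex.exp (L z) := by
    intro z hz
    have hder : ∀ w ∈ Metric.ball (0 : ℂ) r,
        HasDerivWithinAt (fun w => g w * Complex.exp (-L w)) 0 (Metric.ball 0 r) w := by
      intro w hw
      have h1 := ((hg w).hasDerivAt.mul (hL w hw).neg.cexp)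
      convert! h1.hasDerivWithinAt using 1
      field_simp [hgne w hw]
      ring
    have hconst := (convex_ball (0 : ℂ) r).norm_image_sub_le_of_norm_hasDerivWithin_le
      hder (C := 0) (by simp) (Metric.mem_ball_self hr) hz
    simp only [hL0, hg0, neg_zero, Complex.exp_zero, mul_one, zero_mul, norm_le_zero_iff,
      sub_eq_zero] at hconst
    rw [← hconst, mul_assoc, ← Complex.exp_add]
    simp
  have hre : Set.MapsTo L (Metric.ball 0 r) {z | z.re ≤ M} := by
    intro z hz
    have h1 := hgbound z (Metric.ball_subset_closedBall
      (Metric.ball_subset_ball (by linarith) hz))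
    rw [hexp z hz, norm_mul, Complex.norm_exp] at h1
    exact Real.exp_le_exp.mp (le_of_mul_le_mul_left h1 (norm_pos_iff.mpr h0))
  -- Borel–Carathéodory bounds `L` by `2M` on half the disc, Cauchy on circles of radius `r/4`
  -- bounds `L'` by `8M/r`, and the Schwarz lemma for `L'`, which vanishes at `0`, gives the slope
  -- `32M/r²`.
  have hLb : ∀ z, ‖z‖ ≤ r / 2 → ‖L z‖ ≤ 2 * M := by
    intro z hz
    have hzr : ‖z‖ < r := by linarith
    refine (Complex.borelCaratheodory_zero hM hLd hre hr (mem_ball_zero_iff.mpr hzr) hL0).trans ?_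
    rw [div_le_iff₀ (by linarith)]
    nlinarith
  have hr4 : 0 < r / 4 := by positivity
  have hL'b : ∀ z, ‖z‖ < r / 4 → ‖deriv g z / g z‖ ≤ 8 * M / r := by
    intro z hz
    have hsub : Metric.closedBall z (r / 4) ⊆ Metric.ball 0 r := by
      intro w hw
      rw [mem_closedBall_iff_norm] at hw
      rw [mem_ball_zero_iff]
      have := norm_sub_norm_le w z
      linarith
    rw [← (hL z (mem_ball_zero_iff.mpr (by linarith))).deriv]
    have := Complex.norm_deriv_le_of_forall_mem_sphere_norm_le hr4
      (DifferentiableOn.diffContOnCl (f := L) (hLd.mono (by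
        rw [closure_ball z hr4.ne']; exact hsub))) (C := 2 * M) (fun w hw => hLb w (by
          rw [mem_sphere_iff_norm] at hw
          have := norm_sub_norm_le w z
          linarith))
    convert this using 1
    field_simp
    ring
  have hL'q : ∀ z, ‖z‖ < r / 4 → ‖deriv g z / g z‖ ≤ 32 * M / r ^ 2 * ‖z‖ := by
    intro z hz
    have := Complex.dist_le_div_mul_dist_of_mapsTo_ball (c := (0 : ℂ)) (R₁ := r / 4)
      (R₂ := 8 * M / r) (f := fun z => deriv g z / g z) (z := z)
      (hlog.mono (Metric.ball_subset_ball (by linarith))) (fun w hw => by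
        simpa [hdg0] using hL'b w (mem_ball_zero_iff.mp hw)) (mem_ball_zero_iff.mpr hz)
    simp only [hdg0, zero_div, dist_zero_right] at this
    convert this using 2
    field_simp
    ring
  refine ⟨L, fun z => deriv g z / g z, fun z hz => ⟨hL z (mem_ball_zero_iff.mpr (by linarith)),
    ?_, hL'q z hz, ?_⟩⟩
  · rw [hfg z, hexp z (mem_ball_zero_iff.mpr (by linarith))]
    ring
  · have := (convex_closedBall (0 : ℂ) ‖z‖).norm_image_sub_le_of_norm_hasDerivWithin_le
      (f := L) (x := 0) (y := z) (C := 32 * M / r ^ 2 * ‖z‖)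
      (fun w hw => (hL w (mem_ball_zero_iff.mpr (by
        have := mem_closedBall_zero_iff.mp hw; linarith))).hasDerivWithinAt)
      (fun w hw => by
        have hw' := mem_closedBall_zero_iff.mp hw
        refine (hL'q w (by linarith)).trans ?_
        gcongr) (by simp) (by simp)
    simpa [hL0, pow_two, mul_assoc] using this

theorem eventually_exists_log_quotient_bound {h : ℂ → ℂ} (hd : Differentiable ℂ h)
    (heven : ∀ z, h (-z) = h z) (h0 : h 0 ≠ 0)
    (hgrow : ∀ ε > 0, ∀ᶠ r : ℝ in atTop, ∀ z, ‖z‖ ≤ r → ‖h z‖ ≤ Real.exp (ε * r ^ 2))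
    {Z : ℝ → Finset ℂ} (hZ : ∀ r a, a ∈ Z r ↔ ‖a‖ ≤ r ∧ h a = 0) {ε : ℝ} (hε : 0 < ε) :
    ∀ᶠ r : ℝ in atTop, ∃ L L' : ℂ → ℂ, ∀ z, ‖z‖ < r / 4 → HasDerivAt L (L' z) z ∧
      h z = h 0 * zeroProd h (Z r) z * Complex.exp (L z) ∧
      ‖L' z‖ ≤ ε * ‖z‖ ∧ ‖L z‖ ≤ ε * ‖z‖ ^ 2 := by
  -- With `δ = ε/640`, the growth at radius `3r` costs `9δr²` and another `δr²` absorbs `-log ‖h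
  -- 0‖`; then `M = 10δr²` and `32M/r² = ε/2`.
  have hδ : 0 < ε / 640 := by positivity
  have h3 : Tendsto (fun r : ℝ => 3 * r) atTop atTop := tendsto_id.const_mul_atTop (by norm_num)
  have hsq : Tendsto (fun r : ℝ => ε / 640 * r ^ 2) atTop atTop :=
    (tendsto_pow_atTop two_ne_zero).const_mul_atTop hδ
  filter_upwards [h3.eventually (hgrow _ hδ), hsq.eventually_ge_atTop (-Real.log ‖h 0‖),
    eventually_gt_atTop 0] with r h1 h2 hr
  have hn : 0 < ‖h 0‖ := norm_pos_iff.mpr h0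
  obtain ⟨L, L', hL⟩ := exists_log_quotient_bound hd heven h0 hr
    (M := 10 * (ε / 640) * r ^ 2) (by positivity) (fun z hz => (h1 z hz).trans (by
      nth_rewrite 1 [← Real.exp_log hn]
      rw [← Real.exp_add]
      exact Real.exp_le_exp.mpr (by nlinarith))) (Z r) (hZ r)
  have he : 32 * (10 * (ε / 640) * r ^ 2) / r ^ 2 ≤ ε := by
    field_simp
    linarith
  refine ⟨L, L', fun z hz => ?_⟩
  obtain ⟨a, b, c, d⟩ := hL z hz
  exact ⟨a, b, c.trans (by gcongr), d.trans (by gcongr)⟩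

theorem logDeriv_one_sub_div {a z : ℂ} (ha : a ≠ 0) :
    logDeriv (fun z => 1 - z / a) z = 1 / (z - a) := by
  have : deriv (fun z => 1 - z / a) z = -(1 / a) := by
    simp
  rw [logDeriv_apply, this, show 1 - z / a = -((z - a) / a) by field_simp; ring, neg_div_neg_eq,
    div_div_eq_mul_div, one_div, inv_mul_cancel₀ ha]

theorem logDeriv_zeroProd (f : ℂ → ℂ) {Z : Finset ℂ} (h0 : ∀ a ∈ Z, a ≠ 0) {z : ℂ}
    (hz : z ∉ Z) :
    logDeriv (zeroProd f Z) z = ∑ a ∈ Z, (analyticOrderNatAt f a : ℂ) * (1 / (z - a)) := by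
  have hne : ∀ a ∈ Z, 1 - z / a ≠ 0 := by
    intro a ha
    rw [sub_ne_zero, ne_eq, eq_comm, div_eq_one_iff_eq (h0 a ha)]
    rintro rfl
    exact hz ha
  change logDeriv (fun z => ∏ a ∈ Z, (1 - z / a) ^ analyticOrderNatAt f a) z = _
  rw [logDeriv_prod (f := fun a z => (1 - z / a) ^ analyticOrderNatAt f a)
    (fun a ha => pow_ne_zero _ (hne a ha)) (fun a _ => by fun_prop)]
  refine Finset.sum_congr rfl fun a ha => ?_
  rw [logDeriv_fun_pow (by fun_prop), logDeriv_one_sub_div (h0 a ha)]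

/-- The logarithmic derivative of an even entire function `h` of order less than two is the sum
of `1 / (z - a)` over its zeros `a`, taken in discs of increasing radius. -/
theorem tendsto_sum_one_div_sub {h : ℂ → ℂ} (hd : Differentiable ℂ h)
    (heven : ∀ z, h (-z) = h z) (h0 : h 0 ≠ 0)
    (hgrow : ∀ ε > 0, ∀ᶠ r : ℝ in atTop, ∀ z, ‖z‖ ≤ r → ‖h z‖ ≤ Real.exp (ε * r ^ 2))
    {Z : ℝ → Finset ℂ} (hZ : ∀ r a, a ∈ Z r ↔ ‖a‖ ≤ r ∧ h a = 0) {z : ℂ} (hz : h z ≠ 0) :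
    Tendsto (fun r => ∑ a ∈ Z r, (analyticOrderNatAt h a : ℂ) * (1 / (z - a))) atTop
      (𝓝 (logDeriv h z)) := by
  rw [Metric.tendsto_nhds]
  intro δ hδ
  have hε : 0 < δ / 2 / (‖z‖ + 1) := by positivity
  filter_upwards [eventually_exists_log_quotient_bound hd heven h0 hgrow hZ hε,
    eventually_gt_atTop (4 * ‖z‖)] with r ⟨L, L', hL⟩ hr
  have hZ0 : ∀ a ∈ Z r, a ≠ 0 := by
    rintro a ha rfl
    exact h0 ((hZ r 0).mp ha).2
  have hzr : ‖z‖ < r / 4 := by linarith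
  have hzZ : z ∉ Z r := fun hmem => hz ((hZ r z).mp hmem).2
  have hP := differentiable_zeroProd h (Z r)
  have heq : h =ᶠ[𝓝 z] fun w => h 0 * zeroProd h (Z r) w * Complex.exp (L w) := by
    filter_upwards [Metric.isOpen_ball.mem_nhds (mem_ball_zero_iff.mpr hzr)] with w hw
    exact (hL w (mem_ball_zero_iff.mp hw)).2.1
  obtain ⟨hLd, -, hL'z, -⟩ := hL z hzr
  have hPz := zeroProd_ne_zero h hZ0 hzZ
  have hlog : logDeriv h z = logDeriv (zeroProd h (Z r)) z + L' z := by
    rw [logDeriv_apply, heq.deriv_eq, heq.eq_of_nhds,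
      (((hP z).hasDerivAt.const_mul (h 0)).fun_mul hLd.cexp).deriv, logDeriv_apply]
    field_simp [Complex.exp_ne_zero]
  rw [← logDeriv_zeroProd h hZ0 hzZ, hlog, dist_eq_norm, sub_add_cancel_left, norm_neg]
  calc ‖L' z‖ ≤ δ / 2 / (‖z‖ + 1) * ‖z‖ := hL'z
    _ ≤ δ / 2 := by
      rw [div_mul_eq_mul_div, div_le_iff₀ (by positivity)]
      nlinarith
    _ < δ := by linarith

theorem tendsto_sum_log_norm_one_sub_div {h : ℂ → ℂ} (hd : Differentiable ℂ h)
    (heven : ∀ z, h (-z) = h z) (h0 : h 0 ≠ 0)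
    (hgrow : ∀ ε > 0, ∀ᶠ r : ℝ in atTop, ∀ z, ‖z‖ ≤ r → ‖h z‖ ≤ Real.exp (ε * r ^ 2))
    {Z : ℝ → Finset ℂ} (hZ : ∀ r a, a ∈ Z r ↔ ‖a‖ ≤ r ∧ h a = 0) {z : ℂ} (hz : h z ≠ 0) :
    Tendsto (fun r => ∑ a ∈ Z r, (analyticOrderNatAt h a : ℝ) * Real.log ‖1 - z / a‖) atTop
      (𝓝 (Real.log ‖h z‖ - Real.log ‖h 0‖)) := by
  rw [Metric.tendsto_nhds]
  intro δ hδ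
  have hε : 0 < δ / 2 / (‖z‖ ^ 2 + 1) := by positivity
  filter_upwards [eventually_exists_log_quotient_bound hd heven h0 hgrow hZ hε,
    eventually_gt_atTop (4 * ‖z‖)] with r ⟨L, L', hL⟩ hr
  have hZ0 : ∀ a ∈ Z r, a ≠ 0 := by
    rintro a ha rfl
    exact h0 ((hZ r 0).mp ha).2
  have hzZ : z ∉ Z r := fun hmem => hz ((hZ r z).mp hmem).2
  obtain ⟨-, hfac, -, hLz⟩ := hL z (by linarith)
  have hPz := zeroProd_ne_zero h hZ0 hzZ
  have hsum : ∑ a ∈ Z r, (analyticOrderNatAt h a : ℝ) * Real.log ‖1 - z / a‖ =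
      Real.log ‖zeroProd h (Z r) z‖ := by
    rw [zeroProd, norm_prod, Real.log_prod fun a ha => ?_]
    · simp
    · exact norm_ne_zero_iff.mpr (Finset.prod_ne_zero_iff.mp hPz a ha)
  have hlog : Real.log ‖h z‖ = Real.log ‖h 0‖ + Real.log ‖zeroProd h (Z r) z‖ + (L z).re := by
    rw [hfac, norm_mul, norm_mul, Complex.norm_exp, Real.log_mul (by positivity) (by positivity),
      Real.log_mul (by positivity) (by positivity), Real.log_exp]
  rw [hsum, hlog, Real.dist_eq]
  calc |_| = |(L z).re| := by rw [← abs_neg]; congr 1; ring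
    _ ≤ ‖L z‖ := Complex.abs_re_le_norm _
    _ ≤ δ / 2 / (‖z‖ ^ 2 + 1) * ‖z‖ ^ 2 := hLz
    _ ≤ δ / 2 := by
      rw [div_mul_eq_mul_div, div_le_iff₀ (by positivity)]
      nlinarith
    _ < δ := by linarith

section

/-! ### Size and symmetries of the entire function `ξ` -/

open HurwitzZeta MeasureTheory

/-- The kernel whose Mellin transform is twice the entire completed zeta function at `2 s`. -/
noncomputable def xiKernel (t : ℝ) : ℝ := ((hurwitzEvenFEPair 0).f_modif t).re

theorem one_le_evenKernel_zero {t : ℝ} (ht : 0 < t) : 1 ≤ evenKernel 0 t := by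
  have h := hasSum_int_evenKernel₀ 0 ht
  have h0 := h.nonneg fun n => by
    split_ifs
    · exact le_rfl
    · positivity
  simpa using h0

/-- With `θ = evenKernel 0`, the kernel is `θ - 1` beyond `1` and `θ - t^(-1/2)` before it; both are
nonnegative by `θ ≥ 1` and the functional equation. Positivity lets the real axis dominate vertical
lines. -/
theorem f_modif_eq_xiKernel {t : ℝ} (ht : 0 < t) :
    (hurwitzEvenFEPair 0).f_modif t = (xiKernel t : ℂ) ∧ 0 ≤ xiKernel t := by
  unfold xiKernel
  rcases lt_trichotomy t 1 with h1 | rfl | h1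
  · have hpow : (1 : ℝ) / t ^ (1 / 2 : ℝ) = t ^ (-(1 / 2) : ℝ) := by
      rw [Real.rpow_neg ht.le, one_div]
    have hf : (hurwitzEvenFEPair 0).f_modif t =
        ((evenKernel 0 t - t ^ (-(1 / 2) : ℝ) : ℝ) : ℂ) := by
      simp only [WeakFEPair.f_modif, Pi.add_apply]
      rw [Set.indicator_of_notMem (by simpa using h1.le),
        Set.indicator_of_mem (Set.mem_Ioo.mpr ⟨ht, h1⟩)]
      simp [hurwitzEvenFEPair]
    rw [hf, Complex.ofReal_re]
    refine ⟨rfl, ?_⟩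
    rw [evenKernel_functional_equation, hpow, ← evenKernel_eq_cosKernel_of_zero, sub_nonneg]
    exact le_mul_of_one_le_right (by positivity) (one_le_evenKernel_zero (by positivity))
  · simp [WeakFEPair.f_modif]
  · have hf : (hurwitzEvenFEPair 0).f_modif t = ((evenKernel 0 t - 1 : ℝ) : ℂ) := by
      simp only [WeakFEPair.f_modif, Pi.add_apply]
      rw [Set.indicator_of_mem (by simpa using h1),
        Set.indicator_of_notMem (fun h => absurd h.2 (not_lt.mpr h1.le))]
      simp [hurwitzEvenFEPair]
    rw [hf, Complex.ofReal_re]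
    exact ⟨rfl, sub_nonneg.mpr (one_le_evenKernel_zero ht)⟩

theorem integrableOn_cpow_mul_xiKernel (s : ℂ) :
    IntegrableOn (fun t : ℝ => (t : ℂ) ^ (s / 2 - 1) * (xiKernel t : ℂ)) (Set.Ioi 0) := by
  have h := ((hurwitzEvenFEPair 0).isStrongFEPair_toStrongFEPair.hasMellin (s / 2)).1
  refine IntegrableOn.congr_fun h (fun t ht => ?_) measurableSet_Ioi
  have := (f_modif_eq_xiKernel ht).1
  simp only [WeakFEPair.toStrongFEPair, smul_eq_mul, this]

theorem completedRiemannZeta₀_eq_integral (s : ℂ) :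
    completedRiemannZeta₀ s =
      (∫ t in Set.Ioi (0 : ℝ), (t : ℂ) ^ (s / 2 - 1) * (xiKernel t : ℂ)) / 2 := by
  change (mellin (hurwitzEvenFEPair 0).f_modif (s / 2)) / 2 = _
  rw [mellin]
  congr 1
  refine setIntegral_congr_fun measurableSet_Ioi fun t ht => ?_
  simp only [smul_eq_mul, (f_modif_eq_xiKernel ht).1]

/-- The value of the entire completed zeta function at a real point, as a real integral. -/
noncomputable def xiMoment (σ : ℝ) : ℝ :=
  (∫ t in Set.Ioi (0 : ℝ), t ^ (σ / 2 - 1) * xiKernel t) / 2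

theorem norm_cpow_mul_xiKernel (s : ℂ) {t : ℝ} (ht : 0 < t) :
    ‖(t : ℂ) ^ (s / 2 - 1) * (xiKernel t : ℂ)‖ = t ^ (s.re / 2 - 1) * xiKernel t := by
  rw [norm_mul, Complex.norm_cpow_eq_rpow_re_of_pos ht, Complex.norm_real,
    Real.norm_of_nonneg (f_modif_eq_xiKernel ht).2]
  simp

theorem integrableOn_rpow_mul_xiKernel (σ : ℝ) :
    IntegrableOn (fun t : ℝ => t ^ (σ / 2 - 1) * xiKernel t) (Set.Ioi 0) := by
  refine IntegrableOn.congr_fun (integrableOn_cpow_mul_xiKernel σ).norm (fun t ht => ?_)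
    measurableSet_Ioi
  simpa using norm_cpow_mul_xiKernel σ ht

theorem norm_completedRiemannZeta₀_le (s : ℂ) : ‖completedRiemannZeta₀ s‖ ≤ xiMoment s.re := by
  rw [completedRiemannZeta₀_eq_integral, norm_div, Complex.norm_ofNat, xiMoment]
  gcongr
  refine (norm_integral_le_integral_norm _).trans_eq ?_
  exact setIntegral_congr_fun measurableSet_Ioi fun t ht => norm_cpow_mul_xiKernel s ht

theorem completedRiemannZeta₀_ofReal (σ : ℝ) : completedRiemannZeta₀ σ = xiMoment σ := by
  rw [completedRiemannZeta₀_eq_integral, xiMoment]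
  push_cast
  congr 1
  rw [← integral_complex_ofReal]
  refine setIntegral_congr_fun measurableSet_Ioi fun t (ht : 0 < t) => ?_
  simp only [Complex.ofReal_mul]
  rw [Complex.ofReal_cpow ht.le]
  push_cast
  rfl

theorem completedRiemannZeta₀_conj (s : ℂ) :
    completedRiemannZeta₀ (starRingEnd ℂ s) = starRingEnd ℂ (completedRiemannZeta₀ s) := by
  rw [completedRiemannZeta₀_eq_integral, completedRiemannZeta₀_eq_integral, map_div₀,
    ← integral_conj]
  simp only [map_ofNat]
  congr 1
  refine setIntegral_congr_fun measurableSet_Ioi fun t (ht : 0 < t) => ?_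
  have harg : (t : ℂ).arg ≠ Real.pi := by
    rw [Complex.arg_ofReal_of_nonneg ht.le]
    exact Real.pi_ne_zero.symm
  simp only [map_mul, Complex.conj_ofReal]
  congr 1
  have h := Complex.cpow_conj (t : ℂ) (s / 2 - 1) harg
  rw [Complex.conj_ofReal] at h
  rw [← h, map_sub, map_div₀, map_ofNat, map_one]

theorem xiMoment_one_sub (σ : ℝ) : xiMoment (1 - σ) = xiMoment σ := by
  have h := completedRiemannZeta₀_one_sub σ
  rw [← Complex.ofReal_one, ← Complex.ofReal_sub, completedRiemannZeta₀_ofReal,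
    completedRiemannZeta₀_ofReal] at h
  exact_mod_cast h

/-- Weighted AM–GM applied to `t^(σ/2 - 1)` under the positive kernel makes the moment convex in
`σ`. -/
theorem xiMoment_le {a b σ : ℝ} (ha : a ≤ σ) (hb : σ ≤ b) {M : ℝ} (hMa : xiMoment a ≤ M)
    (hMb : xiMoment b ≤ M) : xiMoment σ ≤ M := by
  obtain ⟨u, v, hu, hv, huv, rfl⟩ : σ ∈ segment ℝ a b := by
    rw [segment_eq_Icc (ha.trans hb)]
    exact ⟨ha, hb⟩
  have key : xiMoment (u • a + v • b) ≤ u * xiMoment a + v * xiMoment b := by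
    simp only [xiMoment, mul_div_assoc', ← add_div]
    gcongr
    rw [← integral_const_mul, ← integral_const_mul, ← integral_add
      ((integrableOn_rpow_mul_xiKernel a).const_mul u)
      ((integrableOn_rpow_mul_xiKernel b).const_mul v)]
    refine setIntegral_mono_on (integrableOn_rpow_mul_xiKernel _)
      (((integrableOn_rpow_mul_xiKernel a).const_mul u).add
      ((integrableOn_rpow_mul_xiKernel b).const_mul v)) measurableSet_Ioi fun t ht => ?_
    have ht' : (0 : ℝ) < t := ht
    have h1 := Real.geom_mean_le_arith_mean2_weighted hu hv
      (Real.rpow_nonneg ht'.le (a / 2 - 1)) (Real.rpow_nonneg ht'.le (b / 2 - 1)) huv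
    rw [← Real.rpow_mul ht'.le, ← Real.rpow_mul ht'.le, ← Real.rpow_add ht'] at h1
    have h2 : (u • a + v • b) / 2 - 1 = (a / 2 - 1) * u + (b / 2 - 1) * v := by
      simp only [smul_eq_mul]
      linear_combination huv
    rw [h2]
    calc _ ≤ (u * t ^ (a / 2 - 1) + v * t ^ (b / 2 - 1)) * xiKernel t :=
          mul_le_mul_of_nonneg_right h1 (f_modif_eq_xiKernel ht').2
      _ = _ := by ring
  have h1 : u * xiMoment a ≤ u * M := by gcongr
  have h2 : v * xiMoment b ≤ v * M := by gcongr
  have h3 : u * M + v * M = M := by rw [← add_mul, huv, one_mul]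
  linarith

theorem norm_completedRiemannZeta₀_le_of_mem_strip {b : ℝ} {s : ℂ} (h1 : 1 - b ≤ s.re)
    (h2 : s.re ≤ b) : ‖completedRiemannZeta₀ s‖ ≤ xiMoment b :=
  (norm_completedRiemannZeta₀_le s).trans
    (xiMoment_le h1 h2 (xiMoment_one_sub b).le le_rfl)

theorem riemannXi_one_sub (s : ℂ) : riemannXi (1 - s) = riemannXi s := by
  rw [riemannXi, riemannXi, completedRiemannZeta₀_one_sub]
  ring

theorem riemannXi_conj (s : ℂ) :
    riemannXi (starRingEnd ℂ s) = starRingEnd ℂ (riemannXi s) := by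
  simp [riemannXi, completedRiemannZeta₀_conj]

theorem riemannXi_two_mul_nat {n : ℕ} (hn : n ≠ 0) :
    riemannXi (2 * n) = 2 * n * (2 * n - 1) * (Real.pi : ℂ) ^ (-(n : ℂ)) * (n - 1).factorial *
      riemannZeta (2 * n) := by
  have h2 : (2 * n : ℂ) ≠ 1 := by
    intro h
    have : 2 * n = 1 := by exact_mod_cast h
    omega
  have h3 : ∀ k : ℕ, (2 * n : ℂ) ≠ -(2 * k) := by
    intro k h
    have : (2 * n + 2 * k : ℂ) = 0 := by rw [h]; ring
    have : 2 * n + 2 * k = 0 := by exact_mod_cast this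
    omega
  have hG : Complex.Gamma (2 * n / 2) = (n - 1).factorial := by
    obtain ⟨m, rfl⟩ := Nat.exists_eq_succ_of_ne_zero hn
    rw [mul_div_cancel_left₀ _ two_ne_zero]
    push_cast
    rw [Complex.Gamma_nat_eq_factorial]
  rw [riemannXi_eq h2 h3, hG, show -(2 * n : ℂ) / 2 = -n by ring]

theorem riemannXi_two : riemannXi 2 = Real.pi / 3 := by
  have h := riemannXi_two_mul_nat one_ne_zero
  simp only [Nat.cast_one, mul_one, riemannZeta_two, tsub_self, Nat.factorial_zero] at h
  rw [h, Complex.cpow_neg, Complex.cpow_one]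
  have := Complex.ofReal_ne_zero.mpr Real.pi_ne_zero
  field_simp
  norm_num

/-- From `ξ(2) = π/3` the value is `(π/3 - 1)/2 ≈ 0.0236`. This one number keeps all zeros away from
the real axis. -/
theorem xiMoment_two_lt : xiMoment 2 < 1 / 42 := by
  have h := riemannXi_two
  rw [riemannXi, show (2 : ℂ) = ((2 : ℝ) : ℂ) by norm_num, completedRiemannZeta₀_ofReal] at h
  have h' : 2 * (2 - 1) * xiMoment 2 + 1 = Real.pi / 3 := by exact_mod_cast h
  have := Real.pi_lt_d4
  linarith

theorem norm_completedRiemannZeta₀_lt_of_mem_strip {s : ℂ} (h1 : -1 ≤ s.re) (h2 : s.re ≤ 2) :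
    ‖completedRiemannZeta₀ s‖ < 1 / 42 :=
  (norm_completedRiemannZeta₀_le_of_mem_strip (by linarith) h2).trans_lt xiMoment_two_lt

/-- A zero satisfies `s (1 - s) Λ₀(s) = 1`, so smallness of `Λ₀` forces `s (1 - s)` to be large. -/
theorem lt_norm_mul_one_sub_of_riemannXi_eq_zero {s : ℂ} (hs : riemannXi s = 0) (h1 : -1 ≤ s.re)
    (h2 : s.re ≤ 2) : 42 < ‖s * (1 - s)‖ := by
  have h := norm_completedRiemannZeta₀_lt_of_mem_strip h1 h2
  have h3 : s * (1 - s) * completedRiemannZeta₀ s = 1 := by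
    rw [riemannXi] at hs
    linear_combination -hs
  have h4 : ‖s * (1 - s)‖ * ‖completedRiemannZeta₀ s‖ = 1 := by rw [← norm_mul, h3, norm_one]
  by_contra! hle
  have := mul_le_mul_of_nonneg_right hle (norm_nonneg (completedRiemannZeta₀ s))
  linarith

theorem riemannXi_half_ne_zero : riemannXi (1 / 2) ≠ 0 := by
  intro h
  have := lt_norm_mul_one_sub_of_riemannXi_eq_zero h (by norm_num) (by norm_num)
  norm_num at this

end

/-! ### Growth of `ξ` on discs about `1/2` -/

theorem norm_riemannZeta_two_mul_nat_le {n : ℕ} (hn : n ≠ 0) : ‖riemannZeta (2 * n)‖ ≤ 2 := by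
  have h2 : 1 < 2 * n := by omega
  have hz := zeta_nat_eq_tsum_of_gt_one h2
  push_cast at hz
  rw [hz]
  refine (tsum_of_norm_bounded hasSum_zeta_two fun k => ?_).trans ?_
  · rw [norm_div, norm_one, norm_pow, Complex.norm_natCast]
    rcases Nat.eq_zero_or_pos k with rfl | hk
    · simp [hn]
    · have : (1 : ℝ) ≤ k := by exact_mod_cast hk
      gcongr
      · omega
  · have := Real.pi_lt_d2
    have := Real.pi_pos
    nlinarith

theorem xiMoment_two_mul_nat_le {n : ℕ} (hn : n ≠ 0) :
    xiMoment (2 * n) ≤ 1 + 2 * (n - 1).factorial := by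
  have h := riemannXi_two_mul_nat hn
  have hcast : (2 * n : ℂ) = ((2 * n : ℝ) : ℂ) := by push_cast; rfl
  have h1 : (1 : ℝ) ≤ n := by exact_mod_cast Nat.one_le_iff_ne_zero.mpr hn
  have hpi : ‖(Real.pi : ℂ) ^ (-(n : ℂ))‖ ≤ 1 := by
    rw [Complex.norm_cpow_eq_rpow_re_of_pos Real.pi_pos]
    refine Real.rpow_le_one_of_one_le_of_nonpos (by linarith [Real.pi_gt_three]) ?_
    simp
  have hA : (0 : ℝ) < 2 * n * (2 * n - 1) := by nlinarith
  have hnorm : ‖(2 * n * (2 * n - 1) : ℂ)‖ = 2 * n * (2 * n - 1) := by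
    rw [show (2 * n * (2 * n - 1) : ℂ) = ((2 * n * (2 * n - 1) : ℝ) : ℂ) by push_cast; rfl,
      Complex.norm_real, Real.norm_of_nonneg hA.le]
  have hkey : ‖riemannXi (2 * n)‖ ≤ 2 * n * (2 * n - 1) * (2 * (n - 1).factorial) := by
    rw [h, norm_mul, norm_mul, norm_mul, hnorm, Complex.norm_natCast]
    calc _ ≤ (2 * n * (2 * n - 1) : ℝ) * 1 * (n - 1).factorial * 2 := by
          gcongr
          exact norm_riemannZeta_two_mul_nat_le hn
      _ = _ := by ring
  rw [riemannXi, hcast, completedRiemannZeta₀_ofReal] at hkey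
  have h2 : 2 * n * (2 * n - 1) * xiMoment (2 * n) + 1 ≤
      2 * n * (2 * n - 1) * (2 * (n - 1).factorial) := by
    refine le_trans (le_abs_self _) ?_
    rw [← Real.norm_eq_abs, ← Complex.norm_real]
    push_cast
    push_cast at hkey
    exact hkey
  by_contra! hlt
  nlinarith

/-- With `n = ⌈r⌉` the disc lies in the strip `1 - 2n ≤ Re s ≤ 2n`, where `Λ₀` is bounded by its
value at `2n`, of size `(n - 1)! ≤ r^r`. The polynomial factors go into `exp(4r + 4)`. -/
theorem norm_riemannXi_half_add_le {r : ℝ} (hr : 1 ≤ r) {z : ℂ} (hz : ‖z‖ ≤ r) :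
    ‖riemannXi (1 / 2 + z)‖ ≤ Real.exp (4 * r + 4 + r * Real.log r) := by
  set n := ⌈r⌉₊ with hn
  have hrn : r ≤ n := Nat.le_ceil r
  have hn0 : n ≠ 0 := by
    rintro h0
    rw [h0] at hrn
    norm_num at hrn
    linarith
  have hn1 : ((n - 1 : ℕ) : ℝ) ≤ r := by
    have := Nat.ceil_lt_add_one (by linarith : 0 ≤ r)
    rw [Nat.cast_sub (Nat.one_le_iff_ne_zero.mpr hn0)]
    push_cast
    linarith
  have hfac : ((n - 1).factorial : ℝ) ≤ Real.exp (r * Real.log r) := by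
    calc ((n - 1).factorial : ℝ) ≤ ((n - 1 : ℕ) : ℝ) ^ (n - 1) := by
          exact_mod_cast Nat.factorial_le_pow (n - 1)
      _ ≤ r ^ (n - 1) := by gcongr
      _ = r ^ ((n - 1 : ℕ) : ℝ) := (Real.rpow_natCast _ _).symm
      _ ≤ r ^ r := Real.rpow_le_rpow_of_exponent_le hr hn1
      _ = _ := by rw [Real.rpow_def_of_pos (by linarith), mul_comm]
  have hre := abs_le.mp ((Complex.abs_re_le_norm z).trans hz)
  have hΛ : ‖completedRiemannZeta₀ (1 / 2 + z)‖ ≤ 3 * Real.exp (r * Real.log r) := by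
    refine (norm_completedRiemannZeta₀_le_of_mem_strip (b := 2 * n) ?_ ?_).trans ?_
    · simp
      linarith
    · simp
      linarith
    · refine (xiMoment_two_mul_nat_le hn0).trans ?_
      have : 1 ≤ Real.exp (r * Real.log r) :=
        Real.one_le_exp (mul_nonneg (by linarith) (Real.log_nonneg hr))
      linarith
  have h1 : ‖(1 / 2 + z : ℂ)‖ ≤ 1 + r := by
    refine (norm_add_le _ _).trans ?_
    norm_num
    linarith
  have h2 : ‖(1 / 2 + z - 1 : ℂ)‖ ≤ 1 + r := by
    rw [show (1 / 2 + z - 1 : ℂ) = z - 1 / 2 by ring]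
    refine (norm_sub_le _ _).trans ?_
    norm_num
    linarith
  have hE : 1 ≤ Real.exp (r * Real.log r) :=
    Real.one_le_exp (mul_nonneg (by linarith) (Real.log_nonneg hr))
  calc ‖riemannXi (1 / 2 + z)‖
      ≤ ‖(1 / 2 + z : ℂ)‖ * ‖(1 / 2 + z - 1 : ℂ)‖ * ‖completedRiemannZeta₀ (1 / 2 + z)‖ + 1 := by
        rw [riemannXi]
        refine (norm_add_le _ _).trans ?_
        rw [norm_mul, norm_mul, norm_one]
    _ ≤ (1 + r) * (1 + r) * (3 * Real.exp (r * Real.log r)) + 1 := by gcongr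
    _ ≤ (2 * r + 2) ^ 2 * Real.exp (r * Real.log r) := by nlinarith
    _ ≤ Real.exp (2 * r + 2) ^ 2 * Real.exp (r * Real.log r) := by
        gcongr
        linarith [Real.add_one_le_exp (2 * r + 2)]
    _ = _ := by
        rw [← Real.exp_nat_mul, ← Real.exp_add]
        congr 1
        push_cast
        ring

theorem eventually_norm_riemannXi_half_add_le {ε : ℝ} (hε : 0 < ε) :
    ∀ᶠ r : ℝ in atTop, ∀ z : ℂ, ‖z‖ ≤ r → ‖riemannXi (1 / 2 + z)‖ ≤ Real.exp (ε * r ^ 2) := by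
  filter_upwards [eventually_ge_atTop 1, eventually_ge_atTop (16 / ε),
    Real.isLittleO_log_id_atTop.def (half_pos hε)] with r h1 h2 h3 z hz
  refine (norm_riemannXi_half_add_le h1 hz).trans (Real.exp_le_exp.mpr ?_)
  rw [id, Real.norm_of_nonneg (Real.log_nonneg h1), Real.norm_of_nonneg (by linarith)] at h3
  rw [div_le_iff₀ hε] at h2
  nlinarith

/-! ### Zeros of `ξ` and of `ζ`, with multiplicity -/

theorem zetaFactor_analyticAt {ρ : ℂ} (h : 0 < ρ.re) :
    AnalyticAt ℂ (fun s : ℂ => s * (s - 1) * (Real.pi : ℂ) ^ (-s / 2) *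
      Complex.Gamma (s / 2)) ρ := by
  have hopen : IsOpen {s : ℂ | 0 < s.re} := isOpen_lt continuous_const Complex.continuous_re
  refine DifferentiableOn.analyticAt (s := {s : ℂ | 0 < s.re}) (fun s hs => ?_) (hopen.mem_nhds h)
  have hG : DifferentiableAt ℂ Complex.Gamma (s / 2) := by
    refine Complex.differentiableAt_Gamma _ fun m hm => ?_
    have h1 := congrArg Complex.re hm
    have h2 : (0 : ℝ) < s.re := hs
    simp at h1
    have : (0 : ℝ) ≤ m := m.cast_nonneg
    linarith
  have hpi : (Real.pi : ℂ) ≠ 0 := Complex.ofReal_ne_zero.mpr Real.pi_ne_zero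
  refine DifferentiableAt.differentiableWithinAt ?_
  refine (DifferentiableAt.mul (by fun_prop) ?_).mul (hG.comp s (by fun_prop))
  exact DifferentiableAt.const_cpow (by fun_prop) (Or.inl hpi)

theorem zetaFactor_ne_zero {s : ℂ} (h : 0 < s.re) (h1 : s ≠ 1) :
    s * (s - 1) * (Real.pi : ℂ) ^ (-s / 2) * Complex.Gamma (s / 2) ≠ 0 := by
  have hs : s ≠ 0 := by
    rintro rfl
    simp at h
  have hpi : (Real.pi : ℂ) ^ (-s / 2) ≠ 0 := by
    simp [Complex.cpow_eq_zero_iff, Real.pi_ne_zero]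
  exact mul_ne_zero (mul_ne_zero (mul_ne_zero hs (sub_ne_zero.mpr h1)) hpi)
    (Complex.Gamma_ne_zero_of_re_pos (by simpa using h))

theorem riemannXi_eq_of_re_pos {s : ℂ} (h : 0 < s.re) (h1 : s ≠ 1) :
    riemannXi s =
      s * (s - 1) * (Real.pi : ℂ) ^ (-s / 2) * Complex.Gamma (s / 2) * riemannZeta s := by
  refine riemannXi_eq h1 fun n hn => ?_
  rw [hn] at h
  simp at h
  linarith [n.cast_nonneg (α := ℝ)]

theorem riemannXi_ne_zero_of_one_le_re {s : ℂ} (h : 1 ≤ s.re) : riemannXi s ≠ 0 := by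
  rcases eq_or_ne s 1 with rfl | h1
  · simp [riemannXi]
  · rw [riemannXi_eq_of_re_pos (by linarith) h1]
    exact mul_ne_zero (zetaFactor_ne_zero (by linarith) h1) (riemannZeta_ne_zero_of_one_le_re h)

/-- `ξ` has no zeros with `Re s ≥ 1`, hence by symmetry none with `Re s ≤ 0`; in between, `ξ` and
`ζ` differ by a nonvanishing factor. -/
theorem riemannXi_eq_zero_iff {s : ℂ} : riemannXi s = 0 ↔ s ∈ nontrivialZetaZeros := by
  constructor
  · intro h
    have h1 : s.re < 1 := by
      by_contra! hle
      exact riemannXi_ne_zero_of_one_le_re hle h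
    have h2 : 0 < s.re := by
      by_contra! hle
      refine riemannXi_ne_zero_of_one_le_re (s := 1 - s) (by simpa using hle) ?_
      rw [riemannXi_one_sub, h]
    have hs1 : s ≠ 1 := by
      rintro rfl
      simp at h1
    rw [riemannXi_eq_of_re_pos h2 hs1] at h
    exact ⟨(mul_eq_zero.mp h).resolve_left (zetaFactor_ne_zero h2 hs1), h2, h1⟩
  · rintro ⟨h, h2, h1⟩
    have hs1 : s ≠ 1 := by
      rintro rfl
      simp at h1
    rw [riemannXi_eq_of_re_pos h2 hs1, h, mul_zero]

theorem one_sub_mem_nontrivialZetaZeros {s : ℂ} (h : s ∈ nontrivialZetaZeros) :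
    1 - s ∈ nontrivialZetaZeros := by
  rwa [← riemannXi_eq_zero_iff, riemannXi_one_sub, riemannXi_eq_zero_iff]

theorem conj_mem_nontrivialZetaZeros {s : ℂ} (h : s ∈ nontrivialZetaZeros) :
    starRingEnd ℂ s ∈ nontrivialZetaZeros := by
  rw [← riemannXi_eq_zero_iff] at h ⊢
  rw [riemannXi_conj, h, map_zero]

theorem criticalLineZetaZeros_subset : criticalLineZetaZeros ⊆ nontrivialZetaZeros :=
  fun s hs => ⟨hs.1, by rw [hs.2]; norm_num, by rw [hs.2]; norm_num⟩

theorem analyticOrderNatAt_riemannXi {ρ : ℂ} (h : ρ ∈ nontrivialZetaZeros) :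
    analyticOrderNatAt riemannXi ρ = zetaZeroMult ρ := by
  have hne : ρ ≠ 1 := by
    rintro rfl
    simpa using h.2.2
  have hopen : IsOpen {s : ℂ | 0 < s.re} := isOpen_lt continuous_const Complex.continuous_re
  have heq : riemannXi =ᶠ[𝓝 ρ]
      (fun s : ℂ => s * (s - 1) * (Real.pi : ℂ) ^ (-s / 2) * Complex.Gamma (s / 2)) *
        riemannZeta := by
    filter_upwards [hopen.mem_nhds h.2.1, isOpen_ne.mem_nhds hne] with s hs hs1
    exact riemannXi_eq_of_re_pos hs hs1
  have hu := zetaFactor_analyticAt h.2.1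
  have hu0 : analyticOrderAt
      (fun s : ℂ => s * (s - 1) * (Real.pi : ℂ) ^ (-s / 2) * Complex.Gamma (s / 2)) ρ = 0 :=
    hu.analyticOrderAt_eq_zero.mpr (zetaFactor_ne_zero h.2.1 hne)
  have hz : AnalyticAt ℂ riemannZeta ρ := analyticOn_riemannZeta _ hne
  rw [zetaZeroMult, analyticOrderNatAt, analyticOrderNatAt, analyticOrderAt_congr heq,
    analyticOrderAt_mul hu hz, hu0, zero_add]

/-- The function `ξ` centred at its point of symmetry. -/
noncomputable def centredXi (p : ℂ) : ℂ := riemannXi (1 / 2 + p)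

theorem differentiable_centredXi : Differentiable ℂ centredXi :=
  differentiable_riemannXi.comp (by fun_prop)

theorem centredXi_neg (p : ℂ) : centredXi (-p) = centredXi p := by
  rw [centredXi, centredXi, ← riemannXi_one_sub]
  congr 1
  ring

theorem centredXi_zero_ne_zero : centredXi 0 ≠ 0 := by
  simpa [centredXi] using riemannXi_half_ne_zero

theorem centredXi_sub_half (s : ℂ) : centredXi (s - 1 / 2) = riemannXi s := by
  simp [centredXi]

theorem analyticOrderNatAt_centredXi {ρ : ℂ} (h : ρ ∈ nontrivialZetaZeros) :
    analyticOrderNatAt centredXi (ρ - 1 / 2) = zetaZeroMult ρ := by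
  rw [← analyticOrderNatAt_riemannXi h,
    (differentiable_centredXi.analyticAt _).analyticOrderNatAt_eq_iff
      (differentiable_centredXi.analyticOrderAt_ne_top centredXi_zero_ne_zero _)]
  obtain ⟨g, hg, hga, hgf⟩ := differentiable_riemannXi.exists_eq_sub_pow_mul ρ
    (differentiable_riemannXi.analyticOrderAt_ne_top riemannXi_half_ne_zero _)
  refine ⟨fun p => g (1 / 2 + p), Differentiable.analyticAt (by fun_prop) _, by simpa using hga,
    .of_forall fun p => ?_⟩
  rw [centredXi, hgf, smul_eq_mul]
  congr 2
  ring

theorem zetaZeroMult_one_sub {ρ : ℂ} (h : ρ ∈ nontrivialZetaZeros) :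
    zetaZeroMult (1 - ρ) = zetaZeroMult ρ := by
  rw [← analyticOrderNatAt_centredXi h,
    ← analyticOrderNatAt_centredXi (one_sub_mem_nontrivialZetaZeros h),
    ← analyticOrderNatAt_comp_neg differentiable_centredXi centredXi_neg centredXi_zero_ne_zero]
  congr 1
  ring

theorem one_le_zetaZeroMult {ρ : ℂ} (h : ρ ∈ nontrivialZetaZeros) : 1 ≤ zetaZeroMult ρ := by
  rw [← analyticOrderNatAt_riemannXi h, Nat.one_le_iff_ne_zero]
  intro h0
  obtain ⟨g, -, hga, hgf⟩ := differentiable_riemannXi.exists_eq_sub_pow_mul ρ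
    (differentiable_riemannXi.analyticOrderAt_ne_top riemannXi_half_ne_zero _)
  have := hgf ρ
  rw [h0, pow_zero, one_mul, riemannXi_eq_zero_iff.mpr h] at this
  exact hga this.symm

/-! ### Sums over the zeros in discs about `1/2` -/

theorem finite_zeros_near (r : ℝ) : {ρ : nontrivialZetaZeros | ‖(ρ : ℂ) - 1 / 2‖ ≤ r}.Finite := by
  have h := ((isCompact_closedBall (1 / 2 : ℂ) r).inter_riemannZetaZeros_finite).preimage
    (f := fun ρ : nontrivialZetaZeros => (ρ : ℂ)) Subtype.val_injective.injOn
  refine h.subset fun ρ hρ => ⟨?_, ρ.2.1⟩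
  simpa [dist_eq_norm] using hρ

/-- The nontrivial zeros in the disc of radius `r` about `1/2`. -/
noncomputable def zerosNear (r : ℝ) : Finset nontrivialZetaZeros := (finite_zeros_near r).toFinset

theorem mem_zerosNear {r : ℝ} {ρ : nontrivialZetaZeros} :
    ρ ∈ zerosNear r ↔ ‖(ρ : ℂ) - 1 / 2‖ ≤ r := by
  simp [zerosNear]

theorem tendsto_zerosNear : Tendsto zerosNear atTop atTop := by
  refine tendsto_atTop_finset_of_monotone (fun a b hab ρ hρ => ?_)
    fun ρ => ⟨_, mem_zerosNear.mpr le_rfl⟩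
  exact mem_zerosNear.mpr ((mem_zerosNear.mp hρ).trans hab)

/-- The involution `ρ ↦ 1 - ρ` of the set of nontrivial zeros. -/
noncomputable def oneSubZero (ρ : nontrivialZetaZeros) : nontrivialZetaZeros :=
  ⟨1 - ρ, one_sub_mem_nontrivialZetaZeros ρ.2⟩

/-- Discs about `1/2` are stable under `ρ ↦ 1 - ρ`, which preserves multiplicities; a disc about any
other point would break this. -/
theorem sum_zerosNear_eq_paired {E : Type*} [NormedField E] [CharZero E] (r : ℝ) (f : ℂ → E) :
    ∑ ρ ∈ zerosNear r, (zetaZeroMult ρ : E) * f ρ =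
      ∑ ρ ∈ zerosNear r, (zetaZeroMult ρ : E) * ((f ρ + f (1 - ρ)) / 2) := by
  have h : ∑ ρ ∈ zerosNear r, (zetaZeroMult ρ : E) * f ρ =
      ∑ ρ ∈ zerosNear r, (zetaZeroMult ρ : E) * f (1 - ρ) := by
    refine Finset.sum_nbij' oneSubZero oneSubZero ?_ ?_ ?_ ?_ ?_
    · intro ρ hρ
      rw [mem_zerosNear] at hρ ⊢
      rwa [oneSubZero, ← norm_neg, show -((1 - ρ : ℂ) - 1 / 2) = ρ - 1 / 2 by ring]
    · intro ρ hρ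
      rw [mem_zerosNear] at hρ ⊢
      rwa [oneSubZero, ← norm_neg, show -((1 - ρ : ℂ) - 1 / 2) = ρ - 1 / 2 by ring]
    · intro ρ _
      simp [oneSubZero]
    · intro ρ _
      simp [oneSubZero]
    · intro ρ _
      simp [oneSubZero, zetaZeroMult_one_sub ρ.2]
  have h2 : ∑ ρ ∈ zerosNear r, (zetaZeroMult ρ : E) * ((f ρ + f (1 - ρ)) / 2) =
      (∑ ρ ∈ zerosNear r, (zetaZeroMult ρ : E) * f ρ +
        ∑ ρ ∈ zerosNear r, (zetaZeroMult ρ : E) * f (1 - ρ)) / 2 := by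
    rw [← Finset.sum_add_distrib, Finset.sum_div]
    exact Finset.sum_congr rfl fun _ _ => by ring
  rw [h2, ← h, add_self_div_two]

/-- The translation of the nontrivial zeros which takes `1/2` to `0`. -/
noncomputable def centreZero : nontrivialZetaZeros ↪ ℂ :=
  ⟨fun ρ => ρ - 1 / 2, fun _ _ hab => Subtype.ext (sub_left_injective hab)⟩

theorem mem_map_zerosNear (r : ℝ) (a : ℂ) :
    a ∈ (zerosNear r).map centreZero ↔ ‖a‖ ≤ r ∧ centredXi a = 0 := by
  rw [Finset.mem_map]
  constructor
  · rintro ⟨ρ, hρ, rfl⟩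
    refine ⟨mem_zerosNear.mp hρ, ?_⟩
    change centredXi (ρ - 1 / 2) = 0
    rw [centredXi_sub_half, riemannXi_eq_zero_iff]
    exact ρ.2
  · rintro ⟨h1, h2⟩
    refine ⟨⟨1 / 2 + a, riemannXi_eq_zero_iff.mp h2⟩, mem_zerosNear.mpr (by simpa using h1), ?_⟩
    simp [centreZero]

theorem tendsto_sum_zerosNear_one_div_sub {s : ℂ} (hs : riemannXi s ≠ 0) :
    Tendsto (fun r => ∑ ρ ∈ zerosNear r, (zetaZeroMult ρ : ℂ) *
      ((1 / (s - ρ) + 1 / (s - (1 - ρ))) / 2)) atTop (𝓝 (logDeriv riemannXi s)) := by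
  have h := tendsto_sum_one_div_sub differentiable_centredXi centredXi_neg centredXi_zero_ne_zero
    (fun ε hε => eventually_norm_riemannXi_half_add_le hε) mem_map_zerosNear (z := s - 1 / 2)
    (by rwa [centredXi_sub_half])
  have hlog : logDeriv centredXi (s - 1 / 2) = logDeriv riemannXi s := by
    rw [logDeriv_apply, logDeriv_apply, centredXi_sub_half]
    congr 1
    change deriv (fun p => riemannXi (1 / 2 + p)) (s - 1 / 2) = _
    rw [deriv_comp_const_add]
    congr 1
    ring
  rw [hlog] at h
  refine h.congr fun r => ?_
  rw [Finset.sum_map, ← sum_zerosNear_eq_paired r fun ρ => 1 / (s - ρ)]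
  refine Finset.sum_congr rfl fun ρ _ => ?_
  change (analyticOrderNatAt centredXi (ρ - 1 / 2) : ℂ) * (1 / (s - 1 / 2 - (ρ - 1 / 2))) = _
  rw [analyticOrderNatAt_centredXi ρ.2, sub_sub_sub_cancel_right]

/-- Minus the square of the distance vector of a zero from `1/2`; it is positive for the zeros on
the critical line. -/
noncomputable def zeroSq (ρ : ℂ) : ℂ := -(ρ - 1 / 2) ^ 2

theorem centred_ne_zero {ρ : ℂ} (h : ρ ∈ nontrivialZetaZeros) : ρ - 1 / 2 ≠ 0 := by
  intro h0
  rw [sub_eq_zero] at h0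
  exact riemannXi_half_ne_zero (h0 ▸ riemannXi_eq_zero_iff.mpr h)

/-- With `q = s - 1/2`, the factors of `ρ` and `1 - ρ` multiply to `1 + q² / zeroSq ρ`, so only
squared distances from `1/2` enter. -/
theorem tendsto_sum_zerosNear_log {s : ℂ} (hs : riemannXi s ≠ 0) :
    Tendsto (fun r => ∑ ρ ∈ zerosNear r, (zetaZeroMult ρ : ℝ) *
      ((Real.log ‖zeroSq ρ + (s - 1 / 2) ^ 2‖ - Real.log ‖zeroSq ρ‖) / 2)) atTop
      (𝓝 (Real.log ‖riemannXi s‖ - Real.log ‖riemannXi (1 / 2)‖)) := by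
  have h := tendsto_sum_log_norm_one_sub_div differentiable_centredXi centredXi_neg
    centredXi_zero_ne_zero
    (fun ε hε => eventually_norm_riemannXi_half_add_le hε) mem_map_zerosNear (z := s - 1 / 2)
    (by rwa [centredXi_sub_half])
  rw [centredXi_sub_half, show centredXi 0 = riemannXi (1 / 2) by simp [centredXi]] at h
  refine h.congr fun r => ?_
  have hterm : ∀ ρ ∈ zerosNear r, (analyticOrderNatAt centredXi (centreZero ρ) : ℝ) *
      Real.log ‖1 - (s - 1 / 2) / centreZero ρ‖ =
      (zetaZeroMult ρ : ℝ) * Real.log ‖1 - (s - 1 / 2) / (ρ - 1 / 2)‖ := fun ρ _ => by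
    rw [← analyticOrderNatAt_centredXi ρ.2]
    rfl
  rw [Finset.sum_map, Finset.sum_congr rfl hterm,
    sum_zerosNear_eq_paired r fun ρ => Real.log ‖1 - (s - 1 / 2) / (ρ - 1 / 2)‖]
  refine Finset.sum_congr rfl fun ρ _ => ?_
  have hρ := centred_ne_zero ρ.2
  have hne : ∀ σ ∈ nontrivialZetaZeros, 1 - (s - 1 / 2) / (σ - 1 / 2) ≠ 0 := by
    intro σ hσ h0
    rw [sub_eq_zero, eq_comm, div_eq_one_iff_eq (centred_ne_zero hσ)] at h0
    exact hs (by rw [sub_left_injective h0]; exact riemannXi_eq_zero_iff.mpr hσ)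
  have h1 := norm_ne_zero_iff.mpr (hne ρ ρ.2)
  have h2 := norm_ne_zero_iff.mpr (hne (1 - ρ) (one_sub_mem_nontrivialZetaZeros ρ.2))
  have hprod : (1 - (s - 1 / 2) / (ρ - 1 / 2)) * (1 - (s - 1 / 2) / (1 - ρ - 1 / 2)) =
      (zeroSq ρ + (s - 1 / 2) ^ 2) / zeroSq ρ := by
    rw [zeroSq, show (1 - ρ - 1 / 2 : ℂ) = -(ρ - 1 / 2) by ring]
    generalize (ρ : ℂ) - 1 / 2 = w at hρ
    generalize s - 1 / 2 = q
    field_simp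
    ring
  rw [← Real.log_mul h1 h2, ← norm_mul, hprod, norm_div, Real.log_div]
  · refine fun h0 => mul_ne_zero h1 h2 ?_
    rw [← norm_mul, hprod, norm_div, h0, zero_div]
  · rw [zeroSq]
    simpa using hρ

/-! ### Logarithmic kernels on the region containing the squared zeros -/

/-- The complex numbers in a sector about the positive axis, on the side of it given by the sign
`σ`. -/
def InSector (σ c : ℝ) (z : ℂ) : Prop := 0 < z.re ∧ 0 ≤ σ * z.im ∧ |z.im| ≤ c * z.re

/-- Addition theorem for the tangent: the slopes combine to `(c₁ + c₂) / (1 - c₁ c₂)`. -/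
theorem InSector.mul {σ c₁ c₂ c₃ : ℝ} {z w : ℂ} (hz : InSector σ c₁ z) (hw : InSector σ c₂ w)
    (hc : c₁ * c₂ < 1) (hc₃ : c₁ + c₂ ≤ c₃ * (1 - c₁ * c₂)) (hc0 : 0 ≤ c₃) :
    InSector σ c₃ (z * w) := by
  obtain ⟨hz1, hz2, hz3⟩ := hz
  obtain ⟨hw1, hw2, hw3⟩ := hw
  have hrr : 0 < z.re * w.re := mul_pos hz1 hw1
  have him : z.im * w.im ≤ c₁ * c₂ * (z.re * w.re) := by
    calc z.im * w.im ≤ |z.im| * |w.im| := by rw [← abs_mul]; exact le_abs_self _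
      _ ≤ (c₁ * z.re) * (c₂ * w.re) :=
        mul_le_mul hz3 hw3 (abs_nonneg _) ((abs_nonneg _).trans hz3)
      _ = _ := by ring
  have hre : (1 - c₁ * c₂) * (z.re * w.re) ≤ (z * w).re := by
    rw [Complex.mul_re]
    linarith
  refine ⟨lt_of_lt_of_le (mul_pos (by linarith) hrr) hre, ?_, ?_⟩
  · rw [Complex.mul_im]
    nlinarith [mul_nonneg hz1.le hw2, mul_nonneg hw1.le hz2]
  · rw [Complex.mul_im]
    calc |z.re * w.im + z.im * w.re| ≤ z.re * |w.im| + |z.im| * w.re := by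
          refine (abs_add_le _ _).trans ?_
          rw [abs_mul, abs_mul, abs_of_pos hz1, abs_of_pos hw1]
      _ ≤ z.re * (c₂ * w.re) + (c₁ * z.re) * w.re := by gcongr
      _ = (c₁ + c₂) * (z.re * w.re) := by ring
      _ ≤ c₃ * (1 - c₁ * c₂) * (z.re * w.re) := by gcongr
      _ = c₃ * ((1 - c₁ * c₂) * (z.re * w.re)) := by ring
      _ ≤ c₃ * (z * w).re := by gcongr

theorem InSector.ne_zero {σ c : ℝ} {z : ℂ} (hz : InSector σ c z) : z ≠ 0 := by
  rintro rfl
  simpa using hz.1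

/-- Numerator and denominator lie in the same closed quadrant, so their arguments differ by at most
`π/2`. -/
theorem InSector.re_div_nonneg {σ c : ℝ} {z w : ℂ} (hz : InSector σ c z) (hσ : σ ^ 2 = 1)
    (h1 : 0 ≤ w.re) (h2 : 0 ≤ σ * w.im) : 0 ≤ (w / z).re := by
  rw [Complex.div_re]
  have h3 : 0 ≤ w.im * z.im := by
    have := mul_nonneg h2 hz.2.1
    have h4 : σ * w.im * (σ * z.im) = σ ^ 2 * (w.im * z.im) := by ring
    rwa [h4, hσ, one_mul] at this
  have := Complex.normSq_nonneg z
  have := hz.1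
  positivity

/-- The condition says that `q` is at most the cosine of the sector's angle `arctan c`. -/
theorem InSector.le_re_inv {σ c q : ℝ} {z : ℂ} (hz : InSector σ c z)
    (hq : q ^ 2 * (1 + c ^ 2) ≤ 1) : q / ‖z‖ ≤ (z⁻¹).re := by
  have hzn : 0 < ‖z‖ := norm_pos_iff.mpr hz.ne_zero
  rw [Complex.inv_re, Complex.normSq_eq_norm_sq, div_le_div_iff₀ hzn (by positivity)]
  have h1 : q * ‖z‖ ≤ z.re := by
    refine le_of_sq_le_sq ?_ hz.1.le
    rw [mul_pow, Complex.sq_norm, Complex.normSq_apply]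
    have h2 : z.im * z.im ≤ c ^ 2 * (z.re * z.re) := by
      have := mul_self_le_mul_self (abs_nonneg _) hz.2.2
      rw [abs_mul_abs_self] at this
      linarith
    have h3 : 0 ≤ z.re * z.re := mul_self_nonneg _
    calc q ^ 2 * (z.re * z.re + z.im * z.im)
        ≤ q ^ 2 * (z.re * z.re + c ^ 2 * (z.re * z.re)) := by gcongr
      _ = q ^ 2 * (1 + c ^ 2) * (z.re * z.re) := by ring
      _ ≤ 1 * (z.re * z.re) := by gcongr
      _ = z.re ^ 2 := by ring
  nlinarith

/-- A region which contains `zeroSq ρ` for all nontrivial zeros `ρ`. -/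
def zeroRegion : Set ℂ := {v | 41 ≤ v.re ∧ v.im ^ 2 ≤ v.re + 1 / 4}

/-- Put `β = Re ρ - 1/2`, `γ = Im ρ`, so `v = γ² - β² - 2iβγ` and `β² ≤ 1/4`. The parabola is `4β²γ²
≤ γ²`; from `|v + 1/4| > 42` follows `Re v = |v| - 2β² > 41`. -/
theorem zeroSq_mem_zeroRegion {ρ : ℂ} (h : ρ ∈ nontrivialZetaZeros) : zeroSq ρ ∈ zeroRegion := by
  have h1 := lt_norm_mul_one_sub_of_riemannXi_eq_zero (riemannXi_eq_zero_iff.mpr h)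
    (by linarith [h.2.1]) (by linarith [h.2.2])
  have h2 : ρ * (1 - ρ) = zeroSq ρ + 1 / 4 := by
    rw [zeroSq]
    ring
  have hre : (zeroSq ρ).re = ρ.im ^ 2 - (ρ.re - 1 / 2) ^ 2 := by
    simp [zeroSq, pow_two]
  have him : (zeroSq ρ).im = -2 * (ρ.re - 1 / 2) * ρ.im := by
    simp [zeroSq, pow_two]
    ring
  have hn : ‖zeroSq ρ‖ = ρ.im ^ 2 + (ρ.re - 1 / 2) ^ 2 := by
    rw [zeroSq, norm_neg, norm_pow, Complex.sq_norm, Complex.normSq_apply]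
    simp
    ring
  have h3 := norm_add_le (zeroSq ρ) (1 / 4)
  rw [← h2, hn] at h3
  norm_num at h3
  have he : (ρ.re - 1 / 2) ^ 2 ≤ 1 / 4 := by nlinarith [h.2.1, h.2.2]
  norm_num at h1
  refine ⟨by rw [hre]; nlinarith, ?_⟩
  rw [him, hre]
  nlinarith [mul_nonneg (sub_nonneg.mpr he) (sq_nonneg ρ.im)]

theorem add_mem_zeroRegion {v : ℂ} (h : v ∈ zeroRegion) {r : ℝ} (hr : 0 ≤ r) :
    v + r ∈ zeroRegion := by
  obtain ⟨h1, h2⟩ := h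
  refine ⟨?_, ?_⟩ <;> simp only [Complex.add_re, Complex.add_im, Complex.ofReal_re,
    Complex.ofReal_im, add_zero] <;> linarith

/-- The sign of the imaginary part. -/
theorem exists_sign (v : ℂ) : ∃ σ : ℝ, σ ^ 2 = 1 ∧ 0 ≤ σ * v.im := by
  rcases le_total 0 v.im with h | h
  · exact ⟨1, by norm_num, by simpa using h⟩
  · exact ⟨-1, by norm_num, by simpa using h⟩

/-- The greatest slope `√(x + 1/4) / x` in the region decreases with `x = Re v`, so testing it at `x
= a` is enough. -/
theorem inSector_add {v : ℂ} (h : v ∈ zeroRegion) {σ : ℝ} (hσ : 0 ≤ σ * v.im) {y : ℝ}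
    (hy : 0 ≤ y) {c a : ℝ} (hc : 0 ≤ c) (ha : 41 ≤ a) (hav : a ≤ v.re)
    (hca : a + 1 / 4 ≤ (c * a) ^ 2) : InSector σ c (v + y) := by
  obtain ⟨h1, h2⟩ := h
  refine ⟨?_, ?_, ?_⟩ <;> simp only [Complex.add_re, Complex.add_im, Complex.ofReal_re,
    Complex.ofReal_im, add_zero]
  · linarith
  · exact hσ
  · have h3 : |v.im| ≤ c * v.re := by
      refine abs_le_of_sq_le_sq ?_ (by positivity)
      refine h2.trans ?_
      have h4 : (a + 1 / 4) * v.re ^ 2 ≤ (c * a) ^ 2 * v.re ^ 2 := by gcongr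
      have h5 : a ^ 2 * (v.re + 1 / 4) ≤ (a + 1 / 4) * v.re ^ 2 := by
        have : 0 ≤ (v.re - a) * (a * v.re + (a + v.re) / 4) :=
          mul_nonneg (by linarith) (by positivity)
        linarith
      have h6 : a ^ 2 * (v.re + 1 / 4) ≤ a ^ 2 * (c * v.re) ^ 2 := by
        calc _ ≤ _ := h5.trans h4
          _ = _ := by ring
      exact le_of_mul_le_mul_left h6 (by positivity)
    refine h3.trans ?_
    gcongr
    linarith

theorem tendsto_log_norm_add_sub_log (v : ℂ) :
    Tendsto (fun r : ℝ => Real.log ‖v + r‖ - Real.log r) atTop (𝓝 0) := by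
  have h1 : Tendsto (fun r : ℝ => ‖v * ((r⁻¹ : ℝ) : ℂ) + 1‖) atTop (𝓝 1) := by
    have : Tendsto (fun r : ℝ => v * ((r⁻¹ : ℝ) : ℂ) + 1) atTop (𝓝 (v * ((0 : ℝ) : ℂ) + 1)) :=
      (((Complex.continuous_ofReal.tendsto 0).comp tendsto_inv_atTop_zero).const_mul v).add_const 1
    simpa using this.norm
  have h2 := (Real.continuousAt_log one_ne_zero).tendsto.comp h1
  rw [Real.log_one] at h2
  refine h2.congr' ?_
  filter_upwards [eventually_gt_atTop 0, h1.eventually_ne one_ne_zero] with r hr hne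
  have h3 : v + r = (v * ((r⁻¹ : ℝ) : ℂ) + 1) * r := by
    have : (r : ℂ) ≠ 0 := Complex.ofReal_ne_zero.mpr hr.ne'
    push_cast
    field_simp
  rw [Function.comp, h3, norm_mul, Real.log_mul hne (by simpa using hr.ne'), Complex.norm_real,
    Real.norm_of_nonneg hr.le, add_sub_cancel_right]

/-- This stands in for `f 0 = -∫ f'`: the kernels are handled through the sign of a derivative and a
limit, without improper integrals. -/
theorem nonneg_of_deriv_nonpos_of_tendsto_zero {f f' : ℝ → ℝ}
    (hf : ∀ r, 0 ≤ r → HasDerivAt f (f' r) r) (hf' : ∀ r, 0 ≤ r → f' r ≤ 0)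
    (hlim : Tendsto f atTop (𝓝 0)) : 0 ≤ f 0 := by
  have hanti : AntitoneOn f (Set.Ici 0) := by
    refine antitoneOn_of_deriv_nonpos (convex_Ici 0)
      (fun r hr => (hf r hr).continuousAt.continuousWithinAt) (fun r hr => ?_) fun r hr => ?_
    · rw [interior_Ici] at hr
      exact (hf r hr.le).differentiableAt.differentiableWithinAt
    · rw [interior_Ici] at hr
      rw [(hf r hr.le).deriv]
      exact hf' r hr.le
  refine le_of_tendsto hlim ?_
  filter_upwards [eventually_ge_atTop 0] with r hr
  exact hanti Set.self_mem_Ici hr hr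

theorem hasDerivAt_log_norm_add {v : ℂ} {r : ℝ} (h : 0 < (v + r).re) :
    HasDerivAt (fun r : ℝ => Real.log ‖v + r‖) ((v + r)⁻¹).re r := by
  have h1 : HasDerivAt (fun z : ℂ => Complex.log (v + z)) ((v + r)⁻¹) (r : ℂ) := by
    have := ((hasDerivAt_id (r : ℂ)).const_add v).clog (Or.inl h)
    simpa using this
  have h2 := h1.real_of_complex
  simpa [Complex.log_re] using h2

/-- The divided difference of `-log ‖v + y‖` over the squares `y` of the distances of `1, 2, 6, 8`
from `1/2`. -/
noncomputable def kernelA (v : ℂ) : ℝ :=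
  Real.log ‖v + (9 / 4 : ℝ)‖ / 3024 - Real.log ‖v + (1 / 4 : ℝ)‖ / 3360 -
    Real.log ‖v + (121 / 4 : ℝ)‖ / 21840 + Real.log ‖v + (225 / 4 : ℝ)‖ / 78624

/-- The divided difference of `-log ‖v + y‖` over the squares `y` of the distances of
`1, 2, 4, 6, 8` from `1/2`. -/
noncomputable def kernelB (v : ℂ) : ℝ :=
  Real.log ‖v + (9 / 4 : ℝ)‖ / 30240 - Real.log ‖v + (1 / 4 : ℝ)‖ / 40320 -
    Real.log ‖v + (49 / 4 : ℝ)‖ / 95040 + Real.log ‖v + (121 / 4 : ℝ)‖ / 393120 -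
    Real.log ‖v + (225 / 4 : ℝ)‖ / 3459456

/-- The reciprocal of minus the derivative of `kernelA`. -/
noncomputable def polyA (w : ℂ) : ℂ :=
  (w + (1 / 4 : ℝ)) * (w + (9 / 4 : ℝ)) * ((w + (121 / 4 : ℝ)) * (w + (225 / 4 : ℝ)))

theorem add_ofReal_ne_zero_of_mem_zeroRegion {w : ℂ} (h : w ∈ zeroRegion) {y : ℝ} (hy : 0 ≤ y) :
    w + y ≠ 0 := by
  intro h0
  have := congrArg Complex.re h0
  simp at this
  linarith [h.1]

theorem hasDerivAt_log_norm_of_mem_zeroRegion {v : ℂ} {r y : ℝ} (h : v + r ∈ zeroRegion)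
    (hy : 0 ≤ y) :
    HasDerivAt (fun r : ℝ => Real.log ‖v + r + y‖) ((v + r + y)⁻¹).re r := by
  have h1 : 0 < (v + y + r).re := by
    have := h.1
    simp at this ⊢
    linarith
  have := hasDerivAt_log_norm_add h1
  simpa only [add_right_comm v (y : ℂ)] using this

theorem hasDerivAt_kernelA {v : ℂ} {r : ℝ} (h : v + r ∈ zeroRegion) :
    HasDerivAt (fun r : ℝ => kernelA (v + r)) (-((polyA (v + r))⁻¹).re) r := by
  have h1 := hasDerivAt_log_norm_of_mem_zeroRegion h (show (0 : ℝ) ≤ 1 / 4 by norm_num)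
  have h2 := hasDerivAt_log_norm_of_mem_zeroRegion h (show (0 : ℝ) ≤ 9 / 4 by norm_num)
  have h3 := hasDerivAt_log_norm_of_mem_zeroRegion h (show (0 : ℝ) ≤ 121 / 4 by norm_num)
  have h4 := hasDerivAt_log_norm_of_mem_zeroRegion h (show (0 : ℝ) ≤ 225 / 4 by norm_num)
  have n1 := add_ofReal_ne_zero_of_mem_zeroRegion h (show (0 : ℝ) ≤ 1 / 4 by norm_num)
  have n2 := add_ofReal_ne_zero_of_mem_zeroRegion h (show (0 : ℝ) ≤ 9 / 4 by norm_num)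
  have n3 := add_ofReal_ne_zero_of_mem_zeroRegion h (show (0 : ℝ) ≤ 121 / 4 by norm_num)
  have n4 := add_ofReal_ne_zero_of_mem_zeroRegion h (show (0 : ℝ) ≤ 225 / 4 by norm_num)
  have hd := (((h2.div_const 3024).sub (h1.div_const 3360)).sub (h3.div_const 21840)).add
    (h4.div_const 78624)
  refine hd.congr_deriv ?_
  -- Partial fractions of `1 / polyA`. After the shift `a = w + 1/4` the roots are `0, -2, -30,
  -- -56`, and the denominators are products of their differences, such as `3360 = 2 · 30 · 56`.
  have key : (v + r + (9 / 4 : ℝ))⁻¹ / (3024 : ℝ) - (v + r + (1 / 4 : ℝ))⁻¹ / (3360 : ℝ) -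
      (v + r + (121 / 4 : ℝ))⁻¹ / (21840 : ℝ) + (v + r + (225 / 4 : ℝ))⁻¹ / (78624 : ℝ) =
      -(polyA (v + r))⁻¹ := by
    unfold polyA
    generalize v + (r : ℂ) = w at n1 n2 n3 n4
    obtain ⟨a, rfl⟩ : ∃ a, w = a - (1 / 4 : ℝ) := ⟨w + (1 / 4 : ℝ), by ring⟩
    have e2 : a - (1 / 4 : ℝ) + (9 / 4 : ℝ) = a + 2 := by push_cast; ring
    have e3 : a - (1 / 4 : ℝ) + (121 / 4 : ℝ) = a + 30 := by push_cast; ring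
    have e4 : a - (1 / 4 : ℝ) + (225 / 4 : ℝ) = a + 56 := by push_cast; ring
    simp only [sub_add_cancel, e2, e3, e4] at n1 n2 n3 n4 ⊢
    push_cast
    field_simp
    ring
  have := congrArg Complex.re key
  simpa only [Complex.add_re, Complex.sub_re, Complex.neg_re, Complex.div_ofReal_re] using this

theorem hasDerivAt_kernelB {v : ℂ} {r : ℝ} (h : v + r ∈ zeroRegion) :
    HasDerivAt (fun r : ℝ => kernelB (v + r))
      (-((polyA (v + r) * (v + r + (49 / 4 : ℝ)))⁻¹).re) r := by
  have h1 := hasDerivAt_log_norm_of_mem_zeroRegion h (show (0 : ℝ) ≤ 1 / 4 by norm_num)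
  have h2 := hasDerivAt_log_norm_of_mem_zeroRegion h (show (0 : ℝ) ≤ 9 / 4 by norm_num)
  have h3 := hasDerivAt_log_norm_of_mem_zeroRegion h (show (0 : ℝ) ≤ 121 / 4 by norm_num)
  have h4 := hasDerivAt_log_norm_of_mem_zeroRegion h (show (0 : ℝ) ≤ 225 / 4 by norm_num)
  have h5 := hasDerivAt_log_norm_of_mem_zeroRegion h (show (0 : ℝ) ≤ 49 / 4 by norm_num)
  have n1 := add_ofReal_ne_zero_of_mem_zeroRegion h (show (0 : ℝ) ≤ 1 / 4 by norm_num)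
  have n2 := add_ofReal_ne_zero_of_mem_zeroRegion h (show (0 : ℝ) ≤ 9 / 4 by norm_num)
  have n3 := add_ofReal_ne_zero_of_mem_zeroRegion h (show (0 : ℝ) ≤ 121 / 4 by norm_num)
  have n4 := add_ofReal_ne_zero_of_mem_zeroRegion h (show (0 : ℝ) ≤ 225 / 4 by norm_num)
  have n5 := add_ofReal_ne_zero_of_mem_zeroRegion h (show (0 : ℝ) ≤ 49 / 4 by norm_num)
  have hd := ((((h2.div_const 30240).sub (h1.div_const 40320)).sub (h5.div_const 95040)).add
    (h3.div_const 393120)).sub (h4.div_const 3459456)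
  refine hd.congr_deriv ?_
  have key : (v + r + (9 / 4 : ℝ))⁻¹ / (30240 : ℝ) - (v + r + (1 / 4 : ℝ))⁻¹ / (40320 : ℝ) -
      (v + r + (49 / 4 : ℝ))⁻¹ / (95040 : ℝ) + (v + r + (121 / 4 : ℝ))⁻¹ / (393120 : ℝ) -
      (v + r + (225 / 4 : ℝ))⁻¹ / (3459456 : ℝ) =
      -(polyA (v + r) * (v + r + (49 / 4 : ℝ)))⁻¹ := by
    unfold polyA
    generalize v + (r : ℂ) = w at n1 n2 n3 n4 n5
    obtain ⟨a, rfl⟩ : ∃ a, w = a - (1 / 4 : ℝ) := ⟨w + (1 / 4 : ℝ), by ring⟩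
    have e2 : a - (1 / 4 : ℝ) + (9 / 4 : ℝ) = a + 2 := by push_cast; ring
    have e3 : a - (1 / 4 : ℝ) + (121 / 4 : ℝ) = a + 30 := by push_cast; ring
    have e4 : a - (1 / 4 : ℝ) + (225 / 4 : ℝ) = a + 56 := by push_cast; ring
    have e5 : a - (1 / 4 : ℝ) + (49 / 4 : ℝ) = a + 12 := by push_cast; ring
    simp only [sub_add_cancel, e2, e3, e4, e5] at n1 n2 n3 n4 n5 ⊢
    push_cast
    field_simp
    ring
  have := congrArg Complex.re key
  simpa only [Complex.add_re, Complex.sub_re, Complex.neg_re, Complex.div_ofReal_re] using this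

theorem tendsto_log_norm_add_add_sub_log (v : ℂ) (y : ℝ) :
    Tendsto (fun r : ℝ => Real.log ‖v + r + y‖ - Real.log r) atTop (𝓝 0) := by
  simpa only [add_right_comm v (y : ℂ)] using tendsto_log_norm_add_sub_log (v + y)

/-- The coefficients of a divided difference sum to zero, so the `log r` terms cancel. -/
theorem tendsto_kernelA (v : ℂ) : Tendsto (fun r : ℝ => kernelA (v + r)) atTop (𝓝 0) := by
  have h := fun y => tendsto_log_norm_add_add_sub_log v y
  have hs := ((((h (9 / 4)).div_const 3024).sub ((h (1 / 4)).div_const 3360)).sub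
    ((h (121 / 4)).div_const 21840)).add ((h (225 / 4)).div_const 78624)
  simp only [zero_div, sub_zero, add_zero] at hs
  refine hs.congr fun r => ?_
  unfold kernelA
  ring

theorem tendsto_kernelB (v : ℂ) : Tendsto (fun r : ℝ => kernelB (v + r)) atTop (𝓝 0) := by
  have h := fun y => tendsto_log_norm_add_add_sub_log v y
  have hs := (((((h (9 / 4)).div_const 30240).sub ((h (1 / 4)).div_const 40320)).sub
    ((h (49 / 4)).div_const 95040)).add ((h (121 / 4)).div_const 393120)).sub
    ((h (225 / 4)).div_const 3459456)
  simp only [zero_div, sub_zero, add_zero] at hs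
  refine hs.congr fun r => ?_
  unfold kernelB
  ring

/-- Each linear factor has slope at most `1/6`, a product of two at most `7/20`, a product of four
at most `4/5`. -/
theorem inSector_polyA {v : ℂ} (h : v ∈ zeroRegion) {σ : ℝ} (hσ : 0 ≤ σ * v.im) :
    InSector σ (4 / 5) (polyA v) := by
  have hl : ∀ y : ℝ, 0 ≤ y → InSector σ (1 / 6) (v + y) := fun y hy =>
    inSector_add h hσ hy (by norm_num) le_rfl h.1 (by norm_num)
  exact InSector.mul (c₁ := 7 / 20) (c₂ := 7 / 20)
    ((hl _ (by norm_num)).mul (hl _ (by norm_num)) (by norm_num) (by norm_num) (by norm_num))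
    ((hl _ (by norm_num)).mul (hl _ (by norm_num)) (by norm_num) (by norm_num) (by norm_num))
    (by norm_num) (by norm_num) (by norm_num)

theorem inSector_polyA_of_le {v : ℂ} (h : v ∈ zeroRegion) (hv : 180 ≤ v.re) {σ : ℝ}
    (hσ : 0 ≤ σ * v.im) : InSector σ (31 / 100) (polyA v) := by
  have hl : ∀ y : ℝ, 0 ≤ y → InSector σ (3 / 40) (v + y) := fun y hy =>
    inSector_add h hσ hy (by norm_num) (by norm_num) hv (by norm_num)
  exact InSector.mul (c₁ := 151 / 1000) (c₂ := 151 / 1000)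
    ((hl _ (by norm_num)).mul (hl _ (by norm_num)) (by norm_num) (by norm_num) (by norm_num))
    ((hl _ (by norm_num)).mul (hl _ (by norm_num)) (by norm_num) (by norm_num) (by norm_num))
    (by norm_num) (by norm_num) (by norm_num)

/-- AM–GM, `89/4` being the mean of the four shifts. -/
theorem norm_polyA_le {w : ℂ} {x : ℝ} (hw : ‖w‖ ≤ x) : ‖polyA w‖ ≤ (x + 89 / 4) ^ 4 := by
  have hx : 0 ≤ x := (norm_nonneg w).trans hw
  have hl : ∀ y : ℝ, 0 ≤ y → ‖w + y‖ ≤ x + y := fun y hy => by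
    refine (norm_add_le _ _).trans ?_
    rw [Complex.norm_real, Real.norm_of_nonneg hy]
    gcongr
  rw [polyA, norm_mul, norm_mul, norm_mul]
  calc _ ≤ (x + 1 / 4) * (x + 9 / 4) * ((x + 121 / 4) * (x + 225 / 4)) := by
        gcongr <;> exact hl _ (by norm_num)
    _ ≤ _ := by nlinarith [mul_nonneg hx hx]

/-- In effect `kernelA v = ∫₀^∞ Re (1 / polyA (v + r)) dr`; the integrand is at least `q / ‖polyA‖ ≥
q / (U + r + 89/4)^4`, and this integrates to the bound. -/
theorem le_kernelA {v : ℂ} (h : v ∈ zeroRegion) {σ c q U : ℝ} (hq0 : 0 ≤ q)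
    (hq : q ^ 2 * (1 + c ^ 2) ≤ 1) (hU : ‖v‖ ≤ U)
    (hsec : ∀ r : ℝ, 0 ≤ r → InSector σ c (polyA (v + r))) :
    q / (3 * (U + 89 / 4) ^ 3) ≤ kernelA v := by
  have hU0 : 0 ≤ U := (norm_nonneg v).trans hU
  have key := nonneg_of_deriv_nonpos_of_tendsto_zero
    (f := fun r => kernelA (v + r) - q / (3 * (U + r + 89 / 4) ^ 3))
    (f' := fun r => -((polyA (v + r))⁻¹).re + q / (U + r + 89 / 4) ^ 4) (fun r hr => ?_)
    (fun r hr => ?_) ?_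
  · simp only [Complex.ofReal_zero, add_zero] at key
    linarith
  · have h1 : HasDerivAt (fun r : ℝ => 3 * (U + r + 89 / 4) ^ 3)
        (9 * (U + r + 89 / 4) ^ 2) r := by
      have := ((((hasDerivAt_id r).const_add U).add_const (89 / 4)).pow 3).const_mul 3
      refine this.congr_deriv ?_
      simp
      ring
    have hpos : 0 < U + r + 89 / 4 := by positivity
    have h2 := (hasDerivAt_kernelA (add_mem_zeroRegion h hr)).sub
      ((hasDerivAt_const r q).fun_div h1 (by positivity))
    refine h2.congr_deriv ?_
    field_simp
    ring
  · have hs := hsec r hr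
    have hpos : 0 < ‖polyA (v + r)‖ := norm_pos_iff.mpr hs.ne_zero
    have h1 := hs.le_re_inv hq
    have h2 : ‖polyA (v + r)‖ ≤ (U + r + 89 / 4) ^ 4 := by
      refine norm_polyA_le ((norm_add_le _ _).trans ?_)
      rw [Complex.norm_real, Real.norm_of_nonneg hr]
      gcongr
    have h3 : q / (U + r + 89 / 4) ^ 4 ≤ q / ‖polyA (v + r)‖ := by gcongr
    linarith
  · have h1 : Tendsto (fun r : ℝ => U + r + 89 / 4) atTop atTop :=
      tendsto_atTop_add_const_right _ _ (tendsto_atTop_add_const_left _ _ tendsto_id)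
    have h2 := (((tendsto_pow_atTop three_ne_zero).comp h1).const_mul_atTop
      (show (0 : ℝ) < 3 by norm_num)).const_div_atTop q
    simpa using (tendsto_kernelA v).sub h2

theorem kernelA_nonneg {v : ℂ} (h : v ∈ zeroRegion) : 0 ≤ kernelA v := by
  obtain ⟨σ, -, hσ⟩ := exists_sign v
  have := le_kernelA h (σ := σ) (q := 0) le_rfl (by norm_num) le_rfl fun r hr =>
    inSector_polyA (add_mem_zeroRegion h hr) (by simpa using hσ)
  simpa using this

theorem norm_le_of_mem_zeroRegion {v : ℂ} (h : v ∈ zeroRegion) {a : ℝ} (ha : v.re ≤ a) :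
    ‖v‖ ≤ a + 3 / 5 := by
  obtain ⟨h1, h2⟩ := h
  refine le_of_sq_le_sq ?_ (by linarith)
  rw [Complex.sq_norm, Complex.normSq_apply]
  nlinarith

/-- The constant is such that four half-kernels of this size exceed `kernelASum`. Up to `Re v = 180`
the crude sector suffices; near `236` the margin is thin and the narrower sector, with cosine above
`0.955`, is needed. -/
theorem lt_kernelA {v : ℂ} (h : v ∈ zeroRegion) (hv : v.re ≤ 236) :
    1827 / 10 ^ 11 < kernelA v := by
  obtain ⟨σ, -, hσ⟩ := exists_sign v
  rcases le_total v.re 180 with h1 | h1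
  · refine lt_of_lt_of_le ?_ (le_kernelA h (σ := σ) (q := 3 / 4) (by norm_num) (by norm_num)
      (norm_le_of_mem_zeroRegion h h1) fun r hr =>
        inSector_polyA (add_mem_zeroRegion h hr) (by simpa using hσ))
    norm_num
  · refine lt_of_lt_of_le ?_ (le_kernelA h (σ := σ) (q := 955 / 1000) (by norm_num) (by norm_num)
      (norm_le_of_mem_zeroRegion h hv) fun r hr =>
        inSector_polyA_of_le (add_mem_zeroRegion h hr) (by simp; linarith) (by simpa using hσ))
    norm_num

theorem re_inv_le {z : ℂ} {a : ℝ} (ha : 0 < a) (hz : a ≤ z.re) : (z⁻¹).re ≤ 1 / a := by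
  rw [Complex.inv_re, Complex.normSq_apply,
    div_le_div_iff₀ (by nlinarith [mul_self_nonneg z.im]) ha]
  nlinarith [mul_self_nonneg z.im]

/-- The numerator of the derivative in the comparison of `kernelA` and `kernelB`. -/
noncomputable def kernelComparison (w : ℂ) : ℂ :=
  (65 : ℝ) + ((2811 : ℝ) * (w + (1 / 4 : ℝ))⁻¹ + (4725 / 2 : ℝ) * (w + (9 / 4 : ℝ))⁻¹ -
    (9513 / 2 : ℝ) * (w + (121 / 4 : ℝ))⁻¹ - (12771 : ℝ) * (w + (225 / 4 : ℝ))⁻¹)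

/-- At `Re w = 234` the bounds for the two negative terms take about `18` and `44` out of the
constant `65`. -/
theorem kernelComparison_re_nonneg {w : ℂ} (hw : 234 ≤ w.re) : 0 ≤ (kernelComparison w).re := by
  have hpos : ∀ y : ℝ, 0 ≤ y → 0 ≤ ((w + y)⁻¹).re := fun y hy => by
    rw [Complex.inv_re]
    refine div_nonneg ?_ (Complex.normSq_nonneg _)
    simp
    linarith
  have h3 := re_inv_le (z := w + (121 / 4 : ℝ)) (a := 234 + 121 / 4) (by norm_num) (by
    rw [Complex.add_re, Complex.ofReal_re]; linarith)
  have h4 := re_inv_le (z := w + (225 / 4 : ℝ)) (a := 234 + 225 / 4) (by norm_num) (by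
    rw [Complex.add_re, Complex.ofReal_re]; linarith)
  have h1 := hpos (1 / 4) (by norm_num)
  have h2 := hpos (9 / 4) (by norm_num)
  simp only [kernelComparison, Complex.add_re, Complex.sub_re, Complex.re_ofReal_mul,
    Complex.ofReal_re] at *
  norm_num at *
  linarith

theorem kernelComparison_im_nonneg {w : ℂ} (hw : 234 ≤ w.re) {σ : ℝ} (hσ : 0 ≤ σ * w.im) :
    0 ≤ σ * (kernelComparison w).im := by
  have hn : ∀ y : ℝ, Complex.normSq (w + y) = (w.re + y) ^ 2 + w.im ^ 2 := fun y => by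
    rw [Complex.normSq_apply]
    simp
    ring
  have him : ∀ y : ℝ, ((w + y)⁻¹).im = -w.im / ((w.re + y) ^ 2 + w.im ^ 2) := fun y => by
    rw [Complex.inv_im, hn]
    simp
  simp only [kernelComparison, Complex.add_im, Complex.sub_im, Complex.im_ofReal_mul,
    Complex.ofReal_im, him]
  have hp : ∀ y : ℝ, 0 ≤ y → 0 < (w.re + y) ^ 2 + w.im ^ 2 := fun y hy => by positivity
  have e2 : 1 / ((w.re + 9 / 4) ^ 2 + w.im ^ 2) ≤ 1 / ((w.re + 1 / 4) ^ 2 + w.im ^ 2) := by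
    have := hp (1 / 4) (by norm_num)
    gcongr
    · norm_num
  -- Here `5175` rounds up `2811 + 4725/2`, the total weight of the two nearer poles.
  have e4 : 1 / ((w.re + 1 / 4) ^ 2 + w.im ^ 2) ≤
      (12771 / 5175) * (1 / ((w.re + 225 / 4) ^ 2 + w.im ^ 2)) := by
    rw [mul_one_div, div_le_div_iff₀ (hp _ (by norm_num)) (hp _ (by norm_num))]
    nlinarith [sq_nonneg w.im]
  have e3 : 0 < 1 / ((w.re + 121 / 4) ^ 2 + w.im ^ 2) := by
    have := hp (121 / 4) (by norm_num)
    positivity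
  have e5 : 0 < 1 / ((w.re + 225 / 4) ^ 2 + w.im ^ 2) := by
    have := hp (225 / 4) (by norm_num)
    positivity
  have h0 : 0 ≤ (12771 * (1 / ((w.re + 225 / 4) ^ 2 + w.im ^ 2)) +
      9513 / 2 * (1 / ((w.re + 121 / 4) ^ 2 + w.im ^ 2)) -
      4725 / 2 * (1 / ((w.re + 9 / 4) ^ 2 + w.im ^ 2)) -
      2811 * (1 / ((w.re + 1 / 4) ^ 2 + w.im ^ 2))) := by linarith
  have := mul_nonneg hσ h0
  refine this.trans_eq ?_
  ring

theorem tendsto_inv_add_ofReal_add (v : ℂ) (y : ℝ) :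
    Tendsto (fun r : ℝ => (v + r + y)⁻¹) atTop (𝓝 0) := by
  refine tendsto_inv₀_cobounded.comp ?_
  rw [← tendsto_norm_atTop_iff_cobounded]
  refine tendsto_atTop_mono (f := fun r : ℝ => r + -‖v + y‖) (fun r => ?_)
    (tendsto_atTop_add_const_right _ _ tendsto_id)
  have h1 := norm_sub_le (v + r + y) (v + y)
  rw [add_right_comm, add_sub_cancel_left, Complex.norm_real] at h1
  rw [add_right_comm]
  linarith [le_abs_self r, Real.norm_eq_abs r]

theorem tendsto_sub_div_polyA (v : ℂ) :
    Tendsto (fun r : ℝ => (v + r - (234 : ℝ)) / polyA (v + r)) atTop (𝓝 0) := by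
  have h := fun y => tendsto_inv_add_ofReal_add v y
  have h1 : Tendsto (fun r : ℝ => (1 - (937 / 4 : ℝ) * (v + r + (1 / 4 : ℝ))⁻¹) *
      ((v + r + (9 / 4 : ℝ))⁻¹ * ((v + r + (121 / 4 : ℝ))⁻¹ * (v + r + (225 / 4 : ℝ))⁻¹))) atTop
      (𝓝 ((1 - ((937 / 4 : ℝ) : ℂ) * 0) * (0 * (0 * 0)))) :=
    (tendsto_const_nhds.sub ((h _).const_mul _)).mul ((h _).mul ((h _).mul (h _)))
  simp only [mul_zero] at h1
  refine h1.congr' ?_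
  filter_upwards [eventually_gt_atTop (-v.re)] with r hr
  have hne : v + r + (1 / 4 : ℝ) ≠ 0 := by
    intro h0
    have := congrArg Complex.re h0
    rw [Complex.add_re, Complex.add_re, Complex.ofReal_re, Complex.ofReal_re] at this
    norm_num at this
    linarith
  have h2 : v + r - (234 : ℝ) = (v + r + (1 / 4 : ℝ)) *
      (1 - (937 / 4 : ℝ) * (v + r + (1 / 4 : ℝ))⁻¹) := by
    rw [mul_sub, mul_left_comm, mul_inv_cancel₀ hne]
    push_cast
    ring
  rw [polyA, h2, mul_assoc (v + r + (1 / 4 : ℝ)), mul_div_mul_left _ _ hne, div_eq_mul_inv (1 - _),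
    mul_inv, mul_inv]

/-- The difference `kernelA / 320 - kernelB` alone is not monotone: its derivative has numerator
`-(w + 49/4 - 320) / 320`, which changes sign beyond `234`. The correction `Re ((w - 234) / polyA w)
/ 960` is nonnegative at the start and vanishes at infinity. Because `960 = 3 · 320` and `polyA` has
degree four, it cancels the leading term and leaves `kernelComparison`. -/
theorem kernelB_le {v : ℂ} (h : v ∈ zeroRegion) (hv : 234 ≤ v.re) :
    kernelB v ≤ kernelA v / 320 := by
  obtain ⟨σ, hσ1, hσ⟩ := exists_sign v
  have hσr : ∀ r : ℝ, 0 ≤ σ * (v + r).im := fun r => by simpa using hσ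
  have key := nonneg_of_deriv_nonpos_of_tendsto_zero
    (f := fun r : ℝ => kernelA (v + r) / 320 - kernelB (v + r) -
      ((v + r - (234 : ℝ)) / polyA (v + r)).re / 960)
    (f' := fun r : ℝ => -(kernelComparison (v + r) /
      (polyA (v + r) * (v + r + (49 / 4 : ℝ)))).re / 960) (fun r hr => ?_) (fun r hr => ?_) ?_
  · have h1 := (inSector_polyA h hσ).re_div_nonneg hσ1 (w := v - (234 : ℝ))
      (by simpa using hv) (by simpa using hσ)
    simp only [Complex.ofReal_zero, add_zero] at key
    linarith
  · have hw := add_mem_zeroRegion h hr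
    have hP := (inSector_polyA hw (hσr r)).ne_zero
    have n1 := add_ofReal_ne_zero_of_mem_zeroRegion hw (show (0 : ℝ) ≤ 1 / 4 by norm_num)
    have n2 := add_ofReal_ne_zero_of_mem_zeroRegion hw (show (0 : ℝ) ≤ 9 / 4 by norm_num)
    have n3 := add_ofReal_ne_zero_of_mem_zeroRegion hw (show (0 : ℝ) ≤ 121 / 4 by norm_num)
    have n4 := add_ofReal_ne_zero_of_mem_zeroRegion hw (show (0 : ℝ) ≤ 225 / 4 by norm_num)
    have n5 := add_ofReal_ne_zero_of_mem_zeroRegion hw (show (0 : ℝ) ≤ 49 / 4 by norm_num)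
    have hl : ∀ y : ℝ, HasDerivAt (fun z : ℂ => v + z + y) 1 (r : ℂ) := fun y =>
      ((hasDerivAt_id (r : ℂ)).const_add v).add_const _
    have hPd := ((hl (1 / 4)).fun_mul (hl (9 / 4))).fun_mul
      ((hl (121 / 4)).fun_mul (hl (225 / 4)))
    have hN : HasDerivAt (fun z : ℂ => v + z - (234 : ℝ)) 1 (r : ℂ) :=
      ((hasDerivAt_id (r : ℂ)).const_add v).sub_const _
    have hq := (hN.fun_div hPd hP).real_of_complex
    have hd := (((hasDerivAt_kernelA hw).div_const 320).sub (hasDerivAt_kernelB hw)).sub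
      (hq.div_const 960)
    refine hd.congr_deriv ?_
    simp only [← Complex.div_ofReal_re, ← Complex.neg_re, ← Complex.sub_re]
    congr 1
    unfold kernelComparison polyA
    generalize v + (r : ℂ) = w at n1 n2 n3 n4 n5
    obtain ⟨a, rfl⟩ : ∃ a, w = a - (1 / 4 : ℝ) := ⟨w + (1 / 4 : ℝ), by ring⟩
    have e2 : a - (1 / 4 : ℝ) + (9 / 4 : ℝ) = a + 2 := by push_cast; ring
    have e3 : a - (1 / 4 : ℝ) + (121 / 4 : ℝ) = a + 30 := by push_cast; ring
    have e4 : a - (1 / 4 : ℝ) + (225 / 4 : ℝ) = a + 56 := by push_cast; ring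
    have e5 : a - (1 / 4 : ℝ) + (49 / 4 : ℝ) = a + 12 := by push_cast; ring
    simp only [sub_add_cancel, e2, e3, e4, e5] at n1 n2 n3 n4 n5 ⊢
    push_cast
    field_simp
    ring
  · have hw := add_mem_zeroRegion h hr
    have hre : 234 ≤ (v + r).re := by
      simp
      linarith
    have hsec := (inSector_polyA hw (hσr r)).mul (c₃ := 6 / 5) (inSector_add hw (hσr r)
      (show (0 : ℝ) ≤ 49 / 4 by norm_num) (c := 1 / 6) (by norm_num) le_rfl hw.1 (by norm_num))
      (by norm_num) (by norm_num) (by norm_num)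
    have := hsec.re_div_nonneg hσ1 (kernelComparison_re_nonneg hre)
      (kernelComparison_im_nonneg hre (hσr r))
    linarith
  · have h1 := (Complex.continuous_re.tendsto 0).comp (tendsto_sub_div_polyA v)
    have h2 := (((tendsto_kernelA v).div_const 320).sub (tendsto_kernelB v)).sub
      (h1.div_const 960)
    simpa using h2

/-! ### Numerical values of logarithms and of `ξ` at small integers -/

theorem log_seven_bounds : 1.945910148 < Real.log 7 ∧ Real.log 7 < 1.945910150 := by
  have h := Real.abs_log_sub_add_sum_range_le (x := (1 / 64 : ℝ)) (by norm_num [abs_lt]) 5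
  rw [abs_of_pos (show (0 : ℝ) < 1 / 64 by norm_num), abs_le] at h
  -- Since `63/64 = 3² · 7 / 2⁶`, `log 7` follows from `log 2`, `log 3` and a fast series.
  have h1 : Real.log (1 - 1 / 64) = 2 * Real.log 3 + Real.log 7 - 6 * Real.log 2 := by
    rw [show (1 - 1 / 64 : ℝ) = 3 ^ 2 * 7 / 2 ^ 6 by norm_num,
      Real.log_div (by norm_num) (by norm_num), Real.log_mul (by norm_num) (by norm_num),
      Real.log_pow, Real.log_pow]
    norm_num
  rw [h1] at h
  norm_num [Finset.sum_range_succ] at h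
  have h2 := abs_le.mp Real.log_two_near_10
  have h3 := abs_le.mp Real.log_three_near_10
  norm_num at h2 h3 ⊢
  constructor <;> linarith [h.1, h.2, h2.1, h2.2, h3.1, h3.2]

theorem log_pi_div_three_bounds :
    0.0461175970 < Real.log (Real.pi / 3) ∧ Real.log (Real.pi / 3) < 0.0461175975 := by
  constructor
  · have h := Real.abs_log_sub_add_sum_range_le (x := (1 - 3.1415926535 / 3 : ℝ))
      (by norm_num [abs_lt]) 7
    rw [abs_of_neg (show (1 - 3.1415926535 / 3 : ℝ) < 0 by norm_num), abs_le, sub_sub_cancel] at h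
    have h1 : Real.log (3.1415926535 / 3) ≤ Real.log (Real.pi / 3) := by
      refine Real.log_le_log (by norm_num) ?_
      have := Real.pi_gt_d20
      norm_num at this ⊢
      linarith
    norm_num [Finset.sum_range_succ] at h h1 ⊢
    linarith [h.1]
  · have h := Real.abs_log_sub_add_sum_range_le (x := (1 - 3.1415926536 / 3 : ℝ))
      (by norm_num [abs_lt]) 7
    rw [abs_of_neg (show (1 - 3.1415926536 / 3 : ℝ) < 0 by norm_num), abs_le, sub_sub_cancel] at h
    have h1 : Real.log (Real.pi / 3) ≤ Real.log (3.1415926536 / 3) := by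
      refine Real.log_le_log (by positivity) ?_
      have := Real.pi_lt_d20
      norm_num at this ⊢
      linarith
    norm_num [Finset.sum_range_succ] at h h1 ⊢
    linarith [h.2]

theorem bernoulli_six : bernoulli 6 = 1 / 42 := by
  have h5 : bernoulli' 5 = 0 := bernoulli'_eq_zero_of_odd (by decide) (by norm_num)
  have c2 : Nat.choose 6 2 = 15 := by decide
  have c4 : Nat.choose 6 4 = 15 := by decide
  rw [bernoulli_eq_bernoulli'_of_ne_one (by norm_num), bernoulli'_def]
  norm_num [Finset.sum_range_succ, h5, c2, c4]

theorem bernoulli_eight : bernoulli 8 = -1 / 30 := by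
  have h5 : bernoulli' 5 = 0 := bernoulli'_eq_zero_of_odd (by decide) (by norm_num)
  have h7 : bernoulli' 7 = 0 := bernoulli'_eq_zero_of_odd (by decide) (by norm_num)
  have h6 : bernoulli' 6 = 1 / 42 := by
    rw [← bernoulli_eq_bernoulli'_of_ne_one (by norm_num), bernoulli_six]
  have c2 : Nat.choose 8 2 = 28 := by decide
  have c4 : Nat.choose 8 4 = 70 := by decide
  have c6 : Nat.choose 8 6 = 28 := by decide
  rw [bernoulli_eq_bernoulli'_of_ne_one (by norm_num), bernoulli'_def]
  norm_num [Finset.sum_range_succ, h5, h6, h7, c2, c4, c6]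

theorem riemannXi_four : riemannXi 4 = ((2 * Real.pi ^ 2 / 15 : ℝ) : ℂ) := by
  have h := riemannXi_two_mul_nat two_ne_zero
  push_cast at h
  norm_num at h
  rw [h, riemannZeta_four, Complex.cpow_neg]
  have := Complex.ofReal_ne_zero.mpr Real.pi_ne_zero
  norm_cast
  field_simp
  norm_num

theorem riemannXi_six : riemannXi 6 = ((4 * Real.pi ^ 3 / 63 : ℝ) : ℂ) := by
  have h := riemannXi_two_mul_nat three_ne_zero
  have hz := riemannZeta_two_mul_nat three_ne_zero
  push_cast at h hz
  norm_num [bernoulli_six, Nat.factorial] at h hz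
  rw [h, hz, Complex.cpow_neg]
  have := Complex.ofReal_ne_zero.mpr Real.pi_ne_zero
  norm_cast
  push_cast
  field_simp
  norm_num

theorem riemannXi_eight : riemannXi 8 = ((8 * Real.pi ^ 4 / 225 : ℝ) : ℂ) := by
  have h := riemannXi_two_mul_nat four_ne_zero
  have hz := riemannZeta_two_mul_nat four_ne_zero
  push_cast at h hz
  norm_num [bernoulli_eight, Nat.factorial] at h hz
  rw [h, hz, Complex.cpow_neg]
  have := Complex.ofReal_ne_zero.mpr Real.pi_ne_zero
  norm_cast
  push_cast
  field_simp
  norm_num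

theorem riemannXi_one : riemannXi 1 = 1 := by simp [riemannXi]

/-- The sum of `kernelA` over pairs of zeros. -/
noncomputable def kernelASum : ℝ :=
  Real.log ‖riemannXi 2‖ / 3024 - Real.log ‖riemannXi 1‖ / 3360 -
    Real.log ‖riemannXi 6‖ / 21840 + Real.log ‖riemannXi 8‖ / 78624

/-- The sum of `kernelB` over pairs of zeros. -/
noncomputable def kernelBSum : ℝ :=
  Real.log ‖riemannXi 2‖ / 30240 - Real.log ‖riemannXi 1‖ / 40320 -
    Real.log ‖riemannXi 4‖ / 95040 + Real.log ‖riemannXi 6‖ / 393120 -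
    Real.log ‖riemannXi 8‖ / 3459456

theorem log_norm_riemannXi_two : Real.log ‖riemannXi 2‖ = Real.log (Real.pi / 3) := by
  rw [riemannXi_two, show (Real.pi / 3 : ℂ) = ((Real.pi / 3 : ℝ) : ℂ) by push_cast; rfl,
    Complex.norm_real, Real.norm_of_nonneg (by positivity)]

theorem log_norm_riemannXi_four : Real.log ‖riemannXi 4‖ =
    Real.log 2 + 2 * Real.log (Real.pi / 3) + Real.log 3 - Real.log 5 := by
  rw [riemannXi_four, Complex.norm_real, Real.norm_of_nonneg (by positivity),
    show 2 * Real.pi ^ 2 / 15 = 2 * (Real.pi / 3) ^ 2 * 3 / 5 by ring,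
    Real.log_div (by positivity) (by norm_num), Real.log_mul (by positivity) (by norm_num),
    Real.log_mul (by norm_num) (by positivity), Real.log_pow]
  norm_num

theorem log_norm_riemannXi_six : Real.log ‖riemannXi 6‖ =
    2 * Real.log 2 + 3 * Real.log (Real.pi / 3) + Real.log 3 - Real.log 7 := by
  rw [riemannXi_six, Complex.norm_real, Real.norm_of_nonneg (by positivity),
    show 4 * Real.pi ^ 3 / 63 = 2 ^ 2 * (Real.pi / 3) ^ 3 * 3 / 7 by ring,
    Real.log_div (by positivity) (by norm_num), Real.log_mul (by positivity) (by norm_num),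
    Real.log_mul (by norm_num) (by positivity), Real.log_pow, Real.log_pow]
  norm_num

theorem log_norm_riemannXi_eight : Real.log ‖riemannXi 8‖ =
    3 * Real.log 2 + 4 * Real.log (Real.pi / 3) + 2 * Real.log 3 - 2 * Real.log 5 := by
  rw [riemannXi_eight, Complex.norm_real, Real.norm_of_nonneg (by positivity),
    show 8 * Real.pi ^ 4 / 225 = 2 ^ 3 * (Real.pi / 3) ^ 4 * 3 ^ 2 / 5 ^ 2 by ring,
    Real.log_div (by positivity) (by norm_num), Real.log_mul (by positivity) (by norm_num),
    Real.log_mul (by norm_num) (by positivity), Real.log_pow, Real.log_pow, Real.log_pow,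
    Real.log_pow]
  norm_num

theorem kernelASum_lt : kernelASum < 2 * (1827 / 10 ^ 11) := by
  rw [kernelASum, log_norm_riemannXi_two, log_norm_riemannXi_six, log_norm_riemannXi_eight,
    riemannXi_one, norm_one, Real.log_one]
  have h2 := abs_le.mp Real.log_two_near_10
  have h3 := abs_le.mp Real.log_three_near_10
  have h5 := abs_le.mp Real.log_five_near_10
  have h7 := log_seven_bounds
  have hp := log_pi_div_three_bounds
  norm_num at *
  linarith [h2.1, h2.2, h3.1, h3.2, h5.1, h5.2, h7.1, h7.2, hp.1, hp.2]

theorem kernelASum_div_lt : kernelASum / 320 < kernelBSum := by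
  rw [kernelASum, kernelBSum, log_norm_riemannXi_two, log_norm_riemannXi_four,
    log_norm_riemannXi_six, log_norm_riemannXi_eight, riemannXi_one, norm_one, Real.log_one]
  have h2 := abs_le.mp Real.log_two_near_10
  have h3 := abs_le.mp Real.log_three_near_10
  have h5 := abs_le.mp Real.log_five_near_10
  have h7 := log_seven_bounds
  have hp := log_pi_div_three_bounds
  norm_num at *
  linarith [h2.1, h2.2, h3.1, h3.2, h5.1, h5.2, h7.1, h7.2, hp.1, hp.2]

/-! ### The zero of least modulus lies on the critical line -/

theorem sum_zerosNear_kernelA_tendsto :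
    Tendsto (fun r => ∑ ρ ∈ zerosNear r, (zetaZeroMult ρ : ℝ) * (kernelA (zeroSq ρ) / 2)) atTop
      (𝓝 kernelASum) := by
  have h1 : riemannXi 1 ≠ 0 := riemannXi_ne_zero_of_one_le_re (by norm_num)
  have h2 : riemannXi 2 ≠ 0 := riemannXi_ne_zero_of_one_le_re (by norm_num)
  have h6 : riemannXi 6 ≠ 0 := riemannXi_ne_zero_of_one_le_re (by norm_num)
  have h8 : riemannXi 8 ≠ 0 := riemannXi_ne_zero_of_one_le_re (by norm_num)
  have h := ((((tendsto_sum_zerosNear_log h2).div_const 3024).sub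
    ((tendsto_sum_zerosNear_log h1).div_const 3360)).sub
    ((tendsto_sum_zerosNear_log h6).div_const 21840)).add
    ((tendsto_sum_zerosNear_log h8).div_const 78624)
  have hlim : kernelASum = (Real.log ‖riemannXi 2‖ - Real.log ‖riemannXi (1 / 2)‖) / 3024 -
      (Real.log ‖riemannXi 1‖ - Real.log ‖riemannXi (1 / 2)‖) / 3360 -
      (Real.log ‖riemannXi 6‖ - Real.log ‖riemannXi (1 / 2)‖) / 21840 +
      (Real.log ‖riemannXi 8‖ - Real.log ‖riemannXi (1 / 2)‖) / 78624 := by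
    rw [kernelASum]
    ring
  rw [hlim]
  refine h.congr fun r => ?_
  rw [Finset.sum_div, Finset.sum_div, Finset.sum_div, Finset.sum_div, ← Finset.sum_sub_distrib,
    ← Finset.sum_sub_distrib, ← Finset.sum_add_distrib]
  refine Finset.sum_congr rfl fun ρ _ => ?_
  rw [kernelA]
  norm_num
  ring

theorem sum_zerosNear_kernelB_tendsto :
    Tendsto (fun r => ∑ ρ ∈ zerosNear r, (zetaZeroMult ρ : ℝ) * (kernelB (zeroSq ρ) / 2)) atTop
      (𝓝 kernelBSum) := by
  have h1 : riemannXi 1 ≠ 0 := riemannXi_ne_zero_of_one_le_re (by norm_num)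
  have h2 : riemannXi 2 ≠ 0 := riemannXi_ne_zero_of_one_le_re (by norm_num)
  have h4 : riemannXi 4 ≠ 0 := riemannXi_ne_zero_of_one_le_re (by norm_num)
  have h6 : riemannXi 6 ≠ 0 := riemannXi_ne_zero_of_one_le_re (by norm_num)
  have h8 : riemannXi 8 ≠ 0 := riemannXi_ne_zero_of_one_le_re (by norm_num)
  have h := (((((tendsto_sum_zerosNear_log h2).div_const 30240).sub
    ((tendsto_sum_zerosNear_log h1).div_const 40320)).sub
    ((tendsto_sum_zerosNear_log h4).div_const 95040)).add
    ((tendsto_sum_zerosNear_log h6).div_const 393120)).sub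
    ((tendsto_sum_zerosNear_log h8).div_const 3459456)
  have hlim : kernelBSum = (Real.log ‖riemannXi 2‖ - Real.log ‖riemannXi (1 / 2)‖) / 30240 -
      (Real.log ‖riemannXi 1‖ - Real.log ‖riemannXi (1 / 2)‖) / 40320 -
      (Real.log ‖riemannXi 4‖ - Real.log ‖riemannXi (1 / 2)‖) / 95040 +
      (Real.log ‖riemannXi 6‖ - Real.log ‖riemannXi (1 / 2)‖) / 393120 -
      (Real.log ‖riemannXi 8‖ - Real.log ‖riemannXi (1 / 2)‖) / 3459456 := by
    rw [kernelBSum]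
    ring
  rw [hlim]
  refine h.congr fun r => ?_
  rw [Finset.sum_div, Finset.sum_div, Finset.sum_div, Finset.sum_div, Finset.sum_div,
    ← Finset.sum_sub_distrib, ← Finset.sum_sub_distrib, ← Finset.sum_add_distrib,
    ← Finset.sum_sub_distrib]
  refine Finset.sum_congr rfl fun ρ _ => ?_
  rw [kernelB]
  norm_num
  ring

/-- There is a nontrivial zero of height less than `√235`. -/
theorem exists_zeroSq_re_lt : ∃ ρ ∈ nontrivialZetaZeros, (zeroSq ρ).re < 234 := by
  by_contra! hall
  have h := (sum_zerosNear_kernelA_tendsto.div_const 320).sub sum_zerosNear_kernelB_tendsto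
  have h0 : 0 ≤ kernelASum / 320 - kernelBSum := by
    refine ge_of_tendsto' h fun r => ?_
    rw [Finset.sum_div, ← Finset.sum_sub_distrib]
    refine Finset.sum_nonneg fun ρ _ => ?_
    have h1 := kernelB_le (zeroSq_mem_zeroRegion ρ.2) (hall ρ ρ.2)
    have h2 : (0 : ℝ) ≤ (zetaZeroMult ρ : ℝ) * (kernelA (zeroSq ρ) / 320 - kernelB (zeroSq ρ)) :=
      mul_nonneg (Nat.cast_nonneg _) (by linarith)
    linarith
  linarith [kernelASum_div_lt]

/-- Nonnegativity of `kernelA` allows other zeros and excess multiplicity to be dropped. -/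
theorem sum_kernelA_le (s : Finset nontrivialZetaZeros) :
    ∑ ρ ∈ s, kernelA (zeroSq ρ) / 2 ≤ kernelASum := by
  refine ge_of_tendsto sum_zerosNear_kernelA_tendsto ?_
  filter_upwards [tendsto_zerosNear.eventually_ge_atTop s] with r hr
  calc ∑ ρ ∈ s, kernelA (zeroSq ρ) / 2
      ≤ ∑ ρ ∈ s, (zetaZeroMult ρ : ℝ) * (kernelA (zeroSq ρ) / 2) := by
        refine Finset.sum_le_sum fun ρ _ => ?_
        have h1 : (1 : ℝ) ≤ zetaZeroMult ρ := by exact_mod_cast one_le_zetaZeroMult ρ.2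
        have h2 := kernelA_nonneg (zeroSq_mem_zeroRegion ρ.2)
        exact le_mul_of_one_le_left (by linarith) h1
    _ ≤ _ := by
        refine Finset.sum_le_sum_of_subset_of_nonneg hr fun ρ _ _ => ?_
        have h2 := kernelA_nonneg (zeroSq_mem_zeroRegion ρ.2)
        positivity

/-- The zeros off the critical line have height greater than `√236`. -/
theorem lt_zeroSq_re_of_re_ne_half {ρ : ℂ} (h : ρ ∈ nontrivialZetaZeros) (hρ : ρ.re ≠ 1 / 2) :
    236 < (zeroSq ρ).re := by
  classical
  by_contra! hle
  have him : ρ.im ≠ 0 := by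
    intro h0
    have := (zeroSq_mem_zeroRegion h).1
    simp [zeroSq, pow_two, h0] at this
    nlinarith [mul_self_nonneg (ρ.re - 2⁻¹)]
  -- Off the line and off the real axis, `ρ`, its conjugate and their reflections `1 - ·` are four
  -- distinct zeros sharing `Re (zeroSq ·)`.
  let a : nontrivialZetaZeros := ⟨ρ, h⟩
  let b : nontrivialZetaZeros := ⟨starRingEnd ℂ ρ, conj_mem_nontrivialZetaZeros h⟩
  have hab : a ≠ b := by
    intro heq
    have := congrArg (fun z : nontrivialZetaZeros => (z : ℂ).im) heq
    simp [a, b] at this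
    exact him (by linarith)
  have hac : a ≠ oneSubZero a := by
    intro heq
    have := congrArg (fun z : nontrivialZetaZeros => (z : ℂ).re) heq
    simp [a, oneSubZero] at this
    exact hρ (by linarith)
  have had : a ≠ oneSubZero b := by
    intro heq
    have := congrArg (fun z : nontrivialZetaZeros => (z : ℂ).re) heq
    simp [a, b, oneSubZero] at this
    exact hρ (by linarith)
  have hbc : b ≠ oneSubZero a := by
    intro heq
    have := congrArg (fun z : nontrivialZetaZeros => (z : ℂ).re) heq
    simp [a, b, oneSubZero] at this
    exact hρ (by linarith)
  have hbd : b ≠ oneSubZero b := by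
    intro heq
    have := congrArg (fun z : nontrivialZetaZeros => (z : ℂ).re) heq
    simp [b, oneSubZero] at this
    exact hρ (by linarith)
  have hcd : oneSubZero a ≠ oneSubZero b := by
    intro heq
    have := congrArg (fun z : nontrivialZetaZeros => (z : ℂ).im) heq
    simp [a, b, oneSubZero] at this
    exact him (by linarith)
  have hre : ∀ z ∈ ({a, b, oneSubZero a, oneSubZero b} : Finset nontrivialZetaZeros),
      (zeroSq z).re = (zeroSq ρ).re := by
    intro z hz
    simp only [Finset.mem_insert, Finset.mem_singleton] at hz
    rcases hz with rfl | rfl | rfl | rfl <;> simp [zeroSq, pow_two, a, b, oneSubZero] <;> ring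
  have hsum := sum_kernelA_le {a, b, oneSubZero a, oneSubZero b}
  have hcard : ({a, b, oneSubZero a, oneSubZero b} : Finset nontrivialZetaZeros).card = 4 := by
    rw [Finset.card_insert_of_notMem (by simp [hab, hac, had]),
      Finset.card_insert_of_notMem (by simp [hbc, hbd]), Finset.card_pair hcd]
  have hlow := Finset.card_nsmul_le_sum ({a, b, oneSubZero a, oneSubZero b} :
    Finset nontrivialZetaZeros) (fun z => kernelA (zeroSq z) / 2) (1827 / 10 ^ 11 / 2)
    fun z hz => by
      have := lt_kernelA (zeroSq_mem_zeroRegion z.2) (by rw [hre z hz]; exact hle)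
      linarith
  rw [hcard] at hlow
  have := kernelASum_lt
  norm_num at *
  linarith

/-- Some zero on the critical line has the least modulus of all nontrivial zeros. -/
theorem exists_least_zero :
    ∃ ρ₀ ∈ criticalLineZetaZeros, ∀ ρ ∈ nontrivialZetaZeros, ‖ρ₀‖ ≤ ‖ρ‖ := by
  obtain ⟨ρ₁, h1, hlt⟩ := exists_zeroSq_re_lt
  have hcrit : ρ₁.re = 1 / 2 := by
    by_contra hne
    linarith [lt_zeroSq_re_of_re_ne_half h1 hne]
  have hnorm : ‖(ρ₁ : ℂ) - 1 / 2‖ ≤ ‖ρ₁‖ + 1 := by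
    refine (norm_sub_le _ _).trans ?_
    norm_num
  -- A zero farther than `‖ρ₁‖ + 1` from `1/2` has modulus above `‖ρ₁‖`, so a minimum over this
  -- finite set is global.
  obtain ⟨ρ₀, -, hmin⟩ := Finset.exists_min_image (zerosNear (‖ρ₁‖ + 1)) (fun ρ => ‖(ρ : ℂ)‖)
    ⟨⟨ρ₁, h1⟩, mem_zerosNear.mpr hnorm⟩
  have h01 : ‖(ρ₀ : ℂ)‖ ≤ ‖ρ₁‖ := hmin ⟨ρ₁, h1⟩ (mem_zerosNear.mpr hnorm)
  have hall : ∀ ρ ∈ nontrivialZetaZeros, ‖(ρ₀ : ℂ)‖ ≤ ‖ρ‖ := by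
    intro ρ hρ
    by_cases hmem : ‖ρ - 1 / 2‖ ≤ ‖ρ₁‖ + 1
    · exact hmin ⟨ρ, hρ⟩ (mem_zerosNear.mpr hmem)
    · have := norm_sub_le ρ (1 / 2)
      norm_num at this hmem
      linarith
  refine ⟨ρ₀, ⟨ρ₀.2.1, ?_⟩, hall⟩
  by_contra hne
  have h2 := lt_zeroSq_re_of_re_ne_half ρ₀.2 hne
  -- On the line `‖ρ₁‖² = Re (zeroSq ρ₁) + 1/4 < 234 + 1/4`, whereas an off-line `ρ₀` has `‖ρ₀‖² ≥
  -- (Im ρ₀)² > 236`.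
  have h3 : ‖(ρ₀ : ℂ)‖ ^ 2 ≤ ‖ρ₁‖ ^ 2 := by gcongr
  rw [Complex.sq_norm, Complex.sq_norm, Complex.normSq_apply, Complex.normSq_apply, hcrit] at h3
  simp only [zeroSq, pow_two, Complex.neg_re, Complex.mul_re, Complex.sub_re, Complex.sub_im,
    hcrit] at h2 hlt
  norm_num at h2 hlt h3
  nlinarith [mul_self_nonneg ((ρ₀ : ℂ).re), mul_self_nonneg ((ρ₀ : ℂ).re - 1 / 2)]

/-! ### Power series in one variable given by scalar coefficients -/

theorem hasFPowerSeriesOnBall_ofScalars_of_hasSum {f : ℂ → ℂ} {c : ℕ → ℂ} {R : ℝ} (hR : 0 < R)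
    (h : ∀ z : ℂ, ‖z‖ < R → HasSum (fun k => c k * z ^ k) (f z)) :
    HasFPowerSeriesOnBall f (FormalMultilinearSeries.ofScalars ℂ c) 0 (ENNReal.ofReal R) where
  r_le := by
    refine ENNReal.le_of_forall_nnreal_lt fun r hr => ?_
    have hrR : (r : ℝ) < R := by
      rw [← ENNReal.ofReal_coe_nnreal] at hr
      exact (ENNReal.ofReal_lt_ofReal_iff hR).mp hr
    refine FormalMultilinearSeries.le_radius_of_tendsto _ (l := 0) ?_
    have h0 := (h (r : ℝ) (by simpa using hrR)).summable.tendsto_atTop_zero.norm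
    simpa [FormalMultilinearSeries.ofScalars_norm] using h0
  r_pos := by simpa using hR
  hasSum := by
    intro y hy
    have hy' : ‖y‖ < R := by
      rw [Metric.eball_ofReal] at hy
      simpa using hy
    simpa [FormalMultilinearSeries.ofScalars_apply_eq, mul_comm] using h y hy'

theorem iteratedDeriv_div_factorial_eq_of_hasSum {f : ℂ → ℂ} {c : ℕ → ℂ} {R : ℝ} (hR : 0 < R)
    (h : ∀ z : ℂ, ‖z‖ < R → HasSum (fun k => c k * z ^ k) (f z)) (k : ℕ) :
    iteratedDeriv k f 0 / (k.factorial : ℂ) = c k := by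
  have h1 := (hasFPowerSeriesOnBall_ofScalars_of_hasSum hR h).hasFPowerSeriesAt
  have h2 := h1.analyticAt.hasFPowerSeriesAt
  have h3 := h2.eq_formalMultilinearSeries h1
  exact congrFun ((FormalMultilinearSeries.ofScalars_series_eq_iff (E := ℂ) _ _).mp h3) k

/-- The value `f 0` is immaterial: the sum of the series is continuous at `0` and agrees with `f`
nearby. At `0` only `k = 0` survives, as `0 ^ 0 = 1`. -/
theorem tendsto_nhdsNE_zero_of_hasSum {f : ℂ → ℂ} {c : ℕ → ℂ} {R : ℝ} (hR : 0 < R)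
    (h : ∀ z : ℂ, z ≠ 0 → ‖z‖ < R → HasSum (fun k => c k * z ^ k) (f z)) :
    Tendsto f (𝓝[≠] 0) (𝓝 (∑' k, c k * 0 ^ k)) := by
  have h0 : HasSum (fun k => c k * (0 : ℂ) ^ k) (c 0) := by
    convert hasSum_ite_eq 0 (c 0) using 2 with k
    split_ifs with hk <;> simp [hk]
  have hg : ∀ z : ℂ, ‖z‖ < R → HasSum (fun k => c k * z ^ k) (∑' k, c k * z ^ k) := by
    intro z hz
    rcases eq_or_ne z 0 with rfl | hz0
    · exact h0.summable.hasSum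
    · exact (h z hz0 hz).summable.hasSum
  have hc := (hasFPowerSeriesOnBall_ofScalars_of_hasSum hR hg).analyticAt.continuousAt
  refine (hc.tendsto.mono_left nhdsWithin_le_nhds).congr' ?_
  have hb : ∀ᶠ z : ℂ in 𝓝[≠] 0, ‖z‖ < R := by
    refine Filter.Eventually.filter_mono nhdsWithin_le_nhds ?_
    exact Filter.mem_of_superset (Metric.ball_mem_nhds (0 : ℂ) hR) fun z hz => by simpa using hz
  filter_upwards [hb, self_mem_nhdsWithin] with z hz hz0
  exact (h z hz0 hz).tsum_eq

/-! ### The binomial series with exponent `-x` -/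

theorem ring_choose_eq_gammaQuotient_div (x : ℂ) (k : ℕ) :
    Ring.choose (x + (k + 1 : ℕ) - 1) (k + 1) = gammaQuotient x k / ((k + 1).factorial : ℂ) := by
  rw [eq_div_iff (mod_cast (k + 1).factorial_ne_zero), gammaQuotient_eq_prod, mul_comm,
    ← nsmul_eq_mul, ← Ring.descPochhammer_eq_factorial_smul_choose,
    Polynomial.descPochhammer_smeval_eq_ascPochhammer, Polynomial.ascPochhammer_smeval_eq_eval]
  rw [show x + ((k + 1 : ℕ) : ℂ) - 1 - ((k + 1 : ℕ) : ℂ) + 1 = x by ring]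
  generalize k + 1 = n
  induction n with
  | zero => simp
  | succ n ih => rw [ascPochhammer_succ_eval, ih, Finset.prod_range_succ]

theorem hasSum_one_div_one_sub_cpow_sub_one (x : ℂ) {w : ℂ} (hw : ‖w‖ < 1) :
    HasSum (fun k : ℕ => gammaQuotient x k / ((k + 1).factorial : ℂ) * w ^ (k + 1))
      (1 / (1 - w) ^ x - 1) := by
  have h := (Complex.one_div_one_sub_cpow_hasFPowerSeriesOnBall_zero x).hasSum
    (y := w) (by rw [← ENNReal.ofReal_one, Metric.eball_ofReal]; simpa using hw)
  simp only [FormalMultilinearSeries.ofScalars_apply_eq, zero_add] at h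
  -- Dropping the constant term `1` shifts the index, whence the `k + 1`.
  rw [← hasSum_nat_add_iff' 1] at h
  simpa [← ring_choose_eq_gammaQuotient_div] using h

theorem summable_norm_gammaQuotient_mul_pow (x : ℂ) {t : ℝ} (ht0 : 0 ≤ t) (ht : t < 1) :
    Summable fun k : ℕ => ‖gammaQuotient x k / ((k + 1).factorial : ℂ)‖ * t ^ k := by
  rcases ht0.eq_or_lt with rfl | ht0
  · refine summable_of_ne_finset_zero (s := {0}) fun k hk => ?_
    simp at hk
    simp [hk]
  have h := (hasSum_one_div_one_sub_cpow_sub_one x (w := (t : ℝ))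
    (by simpa [abs_of_pos ht0])).summable.norm
  refine (h.mul_left t⁻¹).congr fun k => ?_
  simp only [norm_mul, norm_pow, Complex.norm_real, Real.norm_eq_abs, abs_of_pos ht0]
  field_simp
  ring

/-! ### Interchange of summation -/

theorem HasSum.swap_of_norm_le {ι κ : Type*} {f : ι → κ → ℂ} {b : ι → ℝ} {d : κ → ℝ}
    (hb : Summable b) (hd : Summable d) (hb0 : ∀ i, 0 ≤ b i) (hd0 : ∀ k, 0 ≤ d k)
    (hf : ∀ i k, ‖f i k‖ ≤ b i * d k) :
    Summable (fun i => ∑' k, f i k) ∧ HasSum (fun k => ∑' i, f i k) (∑' i, ∑' k, f i k) := by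
  have hs : Summable fun p : ι × κ => f p.1 p.2 :=
    Summable.of_norm_bounded (hb.mul_of_nonneg hd hb0 hd0) fun p => hf p.1 p.2
  refine ⟨hs.prod, ?_⟩
  have h1 := hs.hasSum.prod_fiberwise fun i => (hs.prod_factor i).hasSum
  have hs' : Summable fun p : κ × ι => f p.2 p.1 := hs.prod_symm
  have h2 : HasSum (fun p : κ × ι => f p.2 p.1) (∑' p : ι × κ, f p.1 p.2) :=
    (Equiv.prodComm κ ι).hasSum_iff.mpr hs.hasSum
  rw [h1.tsum_eq]
  exact h2.prod_fiberwise fun k => (hs'.prod_factor k).hasSum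

/-! ### Summability over the zeros -/

theorem one_le_norm_of_mem_nontrivialZetaZeros {ρ : ℂ} (h : ρ ∈ nontrivialZetaZeros) :
    1 ≤ ‖ρ‖ := by
  by_contra! hlt
  have h1 := lt_norm_mul_one_sub_of_riemannXi_eq_zero (riemannXi_eq_zero_iff.mpr h)
    (by linarith [h.2.1]) (by linarith [h.2.2])
  have h2 : ‖1 - ρ‖ ≤ 1 + ‖ρ‖ := by simpa using norm_sub_le (1 : ℂ) ρ
  rw [norm_mul] at h1
  nlinarith [norm_nonneg ρ, norm_nonneg (1 - ρ)]

/-- At `s = 3/2` the paired partial fraction is exactly `1 / (1 + zeroSq ρ)`. These numbers lie in a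
narrow sector, so their moduli are controlled by their real parts, and convergence over discs
already forces absolute convergence. -/
theorem summable_zetaZeroMult_div_norm_one_add_zeroSq :
    Summable fun ρ : nontrivialZetaZeros => (zetaZeroMult ρ : ℝ) / ‖1 + zeroSq ρ‖ := by
  have hnear : ∀ ρ : nontrivialZetaZeros, (98 / 100 : ℝ) / ‖1 + zeroSq ρ‖ ≤
      ((1 + zeroSq (ρ : ℂ))⁻¹).re := by
    intro ρ
    have hv := zeroSq_mem_zeroRegion ρ.2
    obtain ⟨σ, -, hσ⟩ := exists_sign (zeroSq (ρ : ℂ))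
    have := inSector_add hv hσ (y := 1) (c := 1 / 6) (a := 41) (by norm_num) (by norm_num) le_rfl
      hv.1 (by norm_num)
    rw [Complex.ofReal_one, add_comm] at this
    exact this.le_re_inv (by norm_num)
  have hs : riemannXi (3 / 2) ≠ 0 := riemannXi_ne_zero_of_one_le_re (by norm_num)
  have ht := (Complex.continuous_re.tendsto _).comp (tendsto_sum_zerosNear_one_div_sub hs)
  have hterm : ∀ ρ : nontrivialZetaZeros, (zetaZeroMult (ρ : ℂ) : ℂ) *
      ((1 / (3 / 2 - (ρ : ℂ)) + 1 / (3 / 2 - (1 - ρ))) / 2) =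
      ((zetaZeroMult (ρ : ℂ) : ℝ) : ℂ) * (1 + zeroSq (ρ : ℂ))⁻¹ := by
    intro ρ
    have h1 : (3 / 2 - (ρ : ℂ)) ≠ 0 := fun h0 => by
      have h := ρ.2.2.2
      rw [← sub_eq_zero.mp h0] at h
      norm_num at h
    have h2 : (3 / 2 - (1 - (ρ : ℂ))) ≠ 0 := fun h0 => by
      have h := ρ.2.2.1
      rw [show (ρ : ℂ) = -1 / 2 by linear_combination h0] at h
      norm_num at h
    have h3 : 1 + zeroSq (ρ : ℂ) = (3 / 2 - (ρ : ℂ)) * (3 / 2 - (1 - ρ)) := by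
      rw [zeroSq]; ring
    rw [h3, div_add_div _ _ h1 h2]
    push_cast
    field_simp
    ring
  simp only [Function.comp_def, Complex.re_sum, hterm, Complex.re_ofReal_mul] at ht
  have hsum : Summable fun ρ : nontrivialZetaZeros =>
      (zetaZeroMult ρ : ℝ) * ((1 + zeroSq (ρ : ℂ))⁻¹).re := by
    have h0 : ∀ ρ : nontrivialZetaZeros,
        0 ≤ (zetaZeroMult ρ : ℝ) * ((1 + zeroSq (ρ : ℂ))⁻¹).re := fun ρ =>
      mul_nonneg (Nat.cast_nonneg _) (le_trans (by positivity) (hnear ρ))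
    refine summable_of_sum_le h0 fun u => ge_of_tendsto ht ?_
    filter_upwards [tendsto_zerosNear.eventually_ge_atTop u] with r hr
    exact Finset.sum_le_sum_of_subset_of_nonneg hr fun ρ _ _ => h0 ρ
  refine Summable.of_nonneg_of_le (fun ρ => by positivity) (fun ρ => ?_) (hsum.mul_left (100 / 98))
  calc (zetaZeroMult (ρ : ℂ) : ℝ) / ‖1 + zeroSq ρ‖
      = 100 / 98 * (zetaZeroMult (ρ : ℂ) * ((98 / 100) / ‖1 + zeroSq ρ‖)) := by ring
    _ ≤ _ := by gcongr; exact hnear ρ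

theorem summable_zetaZeroMult_div_norm_sq :
    Summable fun ρ : nontrivialZetaZeros =>
      (zetaZeroMult ρ : ℝ) * ((‖(ρ : ℂ)‖⁻¹ ^ 2 + ‖1 - (ρ : ℂ)‖⁻¹ ^ 2) / 2) := by
  refine Summable.of_nonneg_of_le (fun ρ => by positivity) (fun ρ => ?_)
    (summable_zetaZeroMult_div_norm_one_add_zeroSq.mul_left 3)
  have key : ∀ z : ℂ, 1 ≤ ‖z‖ → zeroSq z = zeroSq ρ → ‖z‖⁻¹ ^ 2 ≤ 3 / ‖1 + zeroSq ρ‖ := by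
    intro z hz hzρ
    have hv : 1 + zeroSq (ρ : ℂ) = z * (1 - z) + 3 / 4 := by
      rw [← hzρ, zeroSq]; ring
    have hpos : 0 < ‖1 + zeroSq (ρ : ℂ)‖ := by
      refine norm_pos_iff.mpr fun h0 => ?_
      have h1 := (zeroSq_mem_zeroRegion ρ.2).1
      rw [show zeroSq (ρ : ℂ) = -1 by linear_combination h0] at h1
      norm_num at h1
    have h1 : ‖1 - z‖ ≤ 1 + ‖z‖ := by simpa using norm_sub_le (1 : ℂ) z
    have hle : ‖1 + zeroSq (ρ : ℂ)‖ ≤ 3 * ‖z‖ ^ 2 := by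
      rw [hv]
      refine (norm_add_le _ _).trans ?_
      rw [norm_mul, show ‖(3 / 4 : ℂ)‖ = 3 / 4 by norm_num]
      nlinarith
    rw [inv_pow, inv_le_comm₀ (by positivity) (by positivity), inv_div, div_le_iff₀ (by norm_num)]
    linarith
  have h1 := key ρ (one_le_norm_of_mem_nontrivialZetaZeros ρ.2) rfl
  have h2 := key (1 - ρ)
    (one_le_norm_of_mem_nontrivialZetaZeros (one_sub_mem_nontrivialZetaZeros ρ.2))
    (by rw [zeroSq, zeroSq]; ring)
  calc (zetaZeroMult ρ : ℝ) * ((‖(ρ : ℂ)‖⁻¹ ^ 2 + ‖1 - (ρ : ℂ)‖⁻¹ ^ 2) / 2)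
      ≤ zetaZeroMult ρ * ((3 / ‖1 + zeroSq ρ‖ + 3 / ‖1 + zeroSq ρ‖) / 2) := by gcongr
    _ = _ := by ring

/-- The paired contribution of `ρ` to the sum of the powers `ρ^(-k-1)` of the zeros. -/
noncomputable def zeroPowerTerm (k : ℕ) (ρ : ℂ) : ℂ :=
  (zetaZeroMult ρ : ℂ) * ((ρ⁻¹ ^ (k + 1) + (1 - ρ)⁻¹ ^ (k + 1)) / 2)

/-- At `k = 0` pairing gives `1 / (ρ (1 - ρ))`, bounded by the mean of the inverse squares. For `k ≥
1` the powers beyond the second contribute `R^(-(k-1)) = R · R^(-k)`. -/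
theorem norm_zeroPowerTerm_le {R : ℝ} (hR : 1 ≤ R) {ρ : ℂ} (h1 : R ≤ ‖ρ‖) (h2 : R ≤ ‖1 - ρ‖)
    (k : ℕ) : ‖zeroPowerTerm k ρ‖ ≤
      (zetaZeroMult ρ : ℝ) * ((‖ρ‖⁻¹ ^ 2 + ‖1 - ρ‖⁻¹ ^ 2) / 2) * (R * R⁻¹ ^ k) := by
  have hρ : ρ ≠ 0 := norm_pos_iff.mp (by linarith)
  have hρ' : 1 - ρ ≠ 0 := norm_pos_iff.mp (by linarith)
  rw [zeroPowerTerm, norm_mul, Complex.norm_natCast, mul_assoc]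
  refine mul_le_mul_of_nonneg_left ?_ (Nat.cast_nonneg _)
  rw [norm_div, Complex.norm_ofNat, div_mul_eq_mul_div]
  refine div_le_div_of_nonneg_right ?_ (by norm_num)
  rcases k with _ | k
  · have h3 : ρ⁻¹ ^ (0 + 1) + (1 - ρ)⁻¹ ^ (0 + 1) = ρ⁻¹ * (1 - ρ)⁻¹ := by
      rw [zero_add, pow_one, pow_one, inv_add_inv hρ hρ', add_sub_cancel, one_div, mul_inv]
    rw [h3, norm_mul, norm_inv, norm_inv, pow_zero, mul_one]
    have h4 : 0 ≤ ‖ρ‖⁻¹ := by positivity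
    have h5 : 0 ≤ ‖1 - ρ‖⁻¹ := by positivity
    refine le_trans (b := ‖ρ‖⁻¹ ^ 2 + ‖1 - ρ‖⁻¹ ^ 2) ?_ (le_mul_of_one_le_right (by positivity) hR)
    nlinarith [sq_nonneg (‖ρ‖⁻¹ - ‖1 - ρ‖⁻¹)]
  · have hpow : ∀ z : ℂ, R ≤ ‖z‖ → ‖z⁻¹ ^ (k + 1 + 1)‖ ≤ ‖z‖⁻¹ ^ 2 * (R * R⁻¹ ^ (k + 1)) := by
      intro z hz
      rw [norm_pow, norm_inv, show R * R⁻¹ ^ (k + 1) = R⁻¹ ^ k by rw [pow_succ]; field_simp,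
        add_assoc, pow_add, mul_comm]
      gcongr
    rw [add_mul]
    exact (norm_add_le _ _).trans (add_le_add (hpow _ h1) (hpow _ h2))

theorem summable_pow_inv_mul {R t : ℝ} (ht : |t| < R) :
    Summable fun k : ℕ => R * R⁻¹ ^ k * t ^ k := by
  have hR : 0 < R := (abs_nonneg t).trans_lt ht
  refine ((summable_geometric_of_abs_lt_one (r := t / R) ?_).mul_left R).congr fun k => ?_
  · rw [abs_div, abs_of_pos hR, div_lt_one hR]
    exact ht
  · rw [div_pow, inv_pow]
    ring

/-! ### The Taylor coefficients of the logarithmic derivative of `ξ` -/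

theorem hasSum_one_div_sub_of_norm_lt {ρ s : ℂ} (h : ‖s‖ < ‖ρ‖) :
    HasSum (fun k : ℕ => -(ρ⁻¹ ^ (k + 1) * s ^ k)) (1 / (s - ρ)) := by
  have hρ : ρ ≠ 0 := norm_pos_iff.mp ((norm_nonneg s).trans_lt h)
  have hs : s - ρ ≠ 0 := fun h0 => by simp [sub_eq_zero.mp h0] at h
  have hg := (hasSum_geometric_of_norm_lt_one (ξ := s / ρ)
    (by rwa [norm_div, div_lt_one ((norm_nonneg s).trans_lt h)])).mul_left (-ρ⁻¹)
  convert! hg using 1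
  · funext k
    rw [div_pow, inv_pow, pow_succ]
    field_simp
  · rw [one_sub_div hρ, inv_div, ← neg_sub s ρ]
    field_simp

theorem hasSum_logDeriv_riemannXi {R : ℝ} (hR : 1 ≤ R)
    (h : ∀ ρ ∈ nontrivialZetaZeros, R ≤ ‖ρ‖) {s : ℂ} (hs : ‖s‖ < R) :
    HasSum (fun k : ℕ => -(∑' ρ : nontrivialZetaZeros, zeroPowerTerm k ρ) * s ^ k)
      (logDeriv riemannXi s) := by
  have h' : ∀ ρ ∈ nontrivialZetaZeros, R ≤ ‖1 - ρ‖ := fun ρ hρ =>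
    h _ (one_sub_mem_nontrivialZetaZeros hρ)
  have hξ : riemannXi s ≠ 0 := fun h0 => (h s (riemannXi_eq_zero_iff.mp h0)).not_gt hs
  have hterm : ∀ ρ : nontrivialZetaZeros, HasSum (fun k : ℕ => -(zeroPowerTerm k ρ * s ^ k))
      ((zetaZeroMult ρ : ℂ) * ((1 / (s - ρ) + 1 / (s - (1 - ρ))) / 2)) := by
    intro ρ
    convert! (((hasSum_one_div_sub_of_norm_lt (hs.trans_le (h ρ ρ.2))).add
      (hasSum_one_div_sub_of_norm_lt (hs.trans_le (h' ρ ρ.2)))).div_const 2).mul_left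
      (zetaZeroMult ρ : ℂ) using 2 with k
    rw [zeroPowerTerm]
    ring
  obtain ⟨hsum, hswap⟩ := HasSum.swap_of_norm_le
    (f := fun (ρ : nontrivialZetaZeros) k => -(zeroPowerTerm k ρ * s ^ k))
    summable_zetaZeroMult_div_norm_sq (summable_pow_inv_mul (R := R) (t := ‖s‖) (by simpa))
    (fun ρ => by positivity) (fun k => by positivity) (fun ρ k => by
      rw [norm_neg, norm_mul, norm_pow, ← mul_assoc]
      gcongr
      exact norm_zeroPowerTerm_le hR (h ρ ρ.2) (h' ρ ρ.2) k)
  simp only [(hterm _).tsum_eq] at hsum hswap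
  -- Absolute summability identifies the sum over all zeros with its limit over discs.
  have hlim := tendsto_nhds_unique (hsum.hasSum.comp tendsto_zerosNear)
    (tendsto_sum_zerosNear_one_div_sub hξ)
  rw [hlim] at hswap
  simpa only [tsum_neg, tsum_mul_right, neg_mul] using hswap

theorem xiLogDerivCoeff_eq_neg_tsum {R : ℝ} (hR : 1 ≤ R)
    (h : ∀ ρ ∈ nontrivialZetaZeros, R ≤ ‖ρ‖) (k : ℕ) :
    xiLogDerivCoeff k = -∑' ρ : nontrivialZetaZeros, zeroPowerTerm k ρ :=
  iteratedDeriv_div_factorial_eq_of_hasSum (by linarith)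
    (fun _ hs => hasSum_logDeriv_riemannXi hR h hs) k

/-! ### The expansion of `F(x, τ)` -/

theorem hasSum_zetaZeroTerm (x : ℂ) {τ ρ : ℂ} (h : ‖τ‖ < ‖ρ‖) :
    HasSum (fun k : ℕ => -(gammaQuotient x k / ((k + 1).factorial : ℂ) *
      (ρ⁻¹ ^ (k + 1) * τ ^ (k + 1)))) (zetaZeroTerm x τ ρ) := by
  have hρ : ρ ≠ 0 := norm_pos_iff.mp ((norm_nonneg τ).trans_lt h)
  have hw : ‖τ / ρ‖ < 1 := by rwa [norm_div, div_lt_one ((norm_nonneg τ).trans_lt h)]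
  -- Inversion commutes with the principal power away from the negative axis.
  have harg : (1 - τ / ρ).arg ≠ Real.pi := by
    have := Complex.mem_slitPlane_of_norm_lt_one (z := -(τ / ρ)) (by rwa [norm_neg])
    rw [← sub_eq_add_neg] at this
    exact (Complex.mem_slitPlane_iff_arg.mp this).1
  have hval : zetaZeroTerm x τ ρ = -(1 / (1 - τ / ρ) ^ x - 1) := by
    rw [zetaZeroTerm, show ρ / (ρ - τ) = (1 - τ / ρ)⁻¹ by rw [one_sub_div hρ, inv_div],
      Complex.inv_cpow _ _ harg, one_div, neg_sub]
  rw [hval]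
  convert! (hasSum_one_div_one_sub_cpow_sub_one x hw).neg using 3 with k
  rw [div_pow, inv_pow]
  ring

theorem summable_pairedZetaZeroTerm_and_hasSum_liFunction {R : ℝ} (hR : 1 ≤ R)
    (h : ∀ ρ ∈ nontrivialZetaZeros, R ≤ ‖ρ‖) (x : ℂ) {τ : ℂ} (hτ : τ ≠ 0) (hτR : ‖τ‖ < R) :
    (Summable fun ρ : nontrivialZetaZeros => pairedZetaZeroTerm x τ ρ) ∧
      HasSum (fun k : ℕ =>
        xiLogDerivCoeff k / ((k + 1).factorial : ℂ) * gammaQuotient x k * τ ^ k)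
        (liFunction x τ) := by
  have h' : ∀ ρ ∈ nontrivialZetaZeros, R ≤ ‖1 - ρ‖ := fun ρ hρ =>
    h _ (one_sub_mem_nontrivialZetaZeros hρ)
  have hR0 : 0 < R := by linarith
  have hterm : ∀ ρ : nontrivialZetaZeros, HasSum (fun k : ℕ =>
      -(gammaQuotient x k / ((k + 1).factorial : ℂ)) * τ ^ (k + 1) * zeroPowerTerm k ρ)
      (pairedZetaZeroTerm x τ ρ) := by
    intro ρ
    unfold pairedZetaZeroTerm
    convert! (((hasSum_zetaZeroTerm x (hτR.trans_le (h ρ ρ.2))).add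
      (hasSum_zetaZeroTerm x (hτR.trans_le (h' ρ ρ.2)))).div_const 2).mul_left
      (zetaZeroMult ρ : ℂ) using 2 with k
    rw [zeroPowerTerm]
    ring
  have hd : Summable fun k : ℕ => ‖gammaQuotient x k / ((k + 1).factorial : ℂ)‖ *
      (‖τ‖ / R) ^ k * (‖τ‖ * R) :=
    (summable_norm_gammaQuotient_mul_pow x (by positivity) ((div_lt_one hR0).mpr hτR)).mul_right _
  obtain ⟨hsum, hswap⟩ := HasSum.swap_of_norm_le
    (f := fun (ρ : nontrivialZetaZeros) k =>
      -(gammaQuotient x k / ((k + 1).factorial : ℂ)) * τ ^ (k + 1) * zeroPowerTerm k ρ)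
    summable_zetaZeroMult_div_norm_sq hd
    (fun ρ => by positivity) (fun k => by positivity) (fun ρ k => by
      rw [norm_mul, norm_mul, norm_neg, norm_pow]
      calc _ ≤ ‖gammaQuotient x k / ((k + 1).factorial : ℂ)‖ * ‖τ‖ ^ (k + 1) *
            ((zetaZeroMult ρ : ℝ) * ((‖(ρ : ℂ)‖⁻¹ ^ 2 + ‖1 - (ρ : ℂ)‖⁻¹ ^ 2) / 2) *
              (R * R⁻¹ ^ k)) := by
            gcongr
            exact norm_zeroPowerTerm_le hR (h ρ ρ.2) (h' ρ ρ.2) k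
        _ = _ := by
            rw [div_pow, inv_pow, pow_succ]
            ring)
  simp only [(hterm _).tsum_eq] at hsum hswap
  refine ⟨hsum, ?_⟩
  unfold liFunction
  convert! hswap.mul_left (1 / τ) using 2 with k
  rw [tsum_mul_left, xiLogDerivCoeff_eq_neg_tsum hR h, pow_succ]
  field_simp

theorem theorem5p1 :
    ∃ R : ℝ,
      IsLeast ((fun ρ : ℂ => ‖ρ‖) '' criticalLineZetaZeros) R ∧
      IsLeast ((fun ρ : ℂ => ‖ρ‖) '' nontrivialZetaZeros) R ∧
      (∀ x τ : ℂ, τ ≠ 0 → ‖τ‖ < R →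
        (Summable fun ρ : nontrivialZetaZeros => pairedZetaZeroTerm x τ ρ) ∧
        HasSum
          (fun k : ℕ =>
            xiLogDerivCoeff k / ((k + 1).factorial : ℂ) * gammaQuotient x k * τ ^ k)
          (liFunction x τ)) ∧
      (∀ x : ℂ,
        Tendsto (liFunction x) (𝓝[≠] 0)
          (𝓝 (∑' k : ℕ,
            xiLogDerivCoeff k / ((k + 1).factorial : ℂ) * gammaQuotient x k * 0 ^ k))) := by
  obtain ⟨ρ₀, hρ₀, hmin⟩ := exists_least_zero
  have hρ₀' := criticalLineZetaZeros_subset hρ₀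
  have hR := one_le_norm_of_mem_nontrivialZetaZeros hρ₀'
  refine ⟨‖ρ₀‖, ⟨⟨ρ₀, hρ₀, rfl⟩, ?_⟩, ⟨⟨ρ₀, hρ₀', rfl⟩, ?_⟩, fun x τ hτ hτR =>
    summable_pairedZetaZeroTerm_and_hasSum_liFunction hR hmin x hτ hτR, fun x =>
    tendsto_nhdsNE_zero_of_hasSum (by linarith) fun τ hτ hτR =>
      (summable_pairedZetaZeroTerm_and_hasSum_liFunction hR hmin x hτ hτR).2⟩
  · rintro _ ⟨ρ, hρ, rfl⟩
    exact hmin ρ (criticalLineZetaZeros_subset hρ)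
  · rintro _ ⟨ρ, hρ, rfl⟩
    exact hmin ρ hρ
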